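/- Let $d\ge 1$. For a real-valued $u\in W^{1,1}(\mathbb{R}^d)$ let $\nabla u\in L^1(\mathbb{R}^d;\mathbb{R}^d)$ be its weak gradient, and let $u^*$ be its precise representative, $u^*(x)=\lim_{r\to0^+}\frac{1}{|B(x,r)|}\int_{B(x,r)}u\,dy$ where this limit exists in $\mathbb{R}$ and $u^*(x)=0$ elsewhere (so $u^*=u$ if $u$ is continuous). (Meyers–Ziemer trace inequality.) There is a constant $C>0$ depending only on $d$ such that for every $C'>0$, every non-negative Radon measure $\mu$ on $\mathbb{R}^d$ with $$\mu(B(x,r))\le C' r^{d-1}\qquad\text{for all }x\in\mathbb{R}^d,\ r>0,$$ and every $u\in W^{1,1}(\mathbb{R}^d)$, the limit defining $u^*(x)$ exists for $\mu$-almost every $x$, the function $u^*$ is $\mu$-integrable, and $$\int_{\mathbb{R}^d}|u^*|\,d\mu\le C\,C'\int_{\mathbb{R}^d}|\nabla u|\,dx .$$ Moreover, if $d\ge2$, there are constants depending only on $d$, each denoted by $C>0$, such that for every $u\in W^{1,1}(\mathbb{R}^d)$: 1. (Alvino) $\|u\|_{L^{d/(d-1),1}(\mathbb{R}^d)}\le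 C\int_{\mathbb{R}^d}|\nabla u|\,dx$, where for $1<p<\infty$ one sets $\|u\|_{L^{p,1}(\mathbb{R}^d)}:=p\int_0^\infty |\{|u|>t\}|^{1/p}\,dt$; 2. (Gagliardo–Nirenberg) $\|u\|_{L^{d/(d-1)}(\mathbb{R}^d)}\le C\int_{\mathbb{R}^d}|\nabla u|\,dx$; 3. (Hardy) $\int_{\mathbb{R}^d}\frac{|u(x)|}{|x|}\,dx\le C\int_{\mathbb{R}^d}|\nabla u|\,dx$. -/

import Mathlib

open MeasureTheory Filter Topology Set
open scoped ContDiff ENNReal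

noncomputable section

/-- `G` is the weak (distributional) gradient of `u` on `ℝ^d`: for every real-valued test function
`φ ∈ C_c^∞(ℝ^d)` and every `i`, `∫ u ∂ᵢφ dx = - ∫ Gᵢ φ dx`. -/
def HasWeakGradient {d : ℕ} (u : EuclideanSpace ℝ (Fin d) → ℝ)
    (G : EuclideanSpace ℝ (Fin d) → EuclideanSpace ℝ (Fin d)) : Prop :=
  ∀ φ : EuclideanSpace ℝ (Fin d) → ℝ, ContDiff ℝ ∞ φ → HasCompactSupport φ → ∀ i : Fin d,
    ∫ x, u x * fderiv ℝ φ x (EuclideanSpace.single i 1) = - ∫ x, G x i * φ x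

/-- `u ∈ W^{1,1}(ℝ^d)` with weak gradient `G` (which is unique up to Lebesgue-null sets). -/
structure IsW11 {d : ℕ} (u : EuclideanSpace ℝ (Fin d) → ℝ)
    (G : EuclideanSpace ℝ (Fin d) → EuclideanSpace ℝ (Fin d)) : Prop where
  integrable : Integrable u
  integrable_grad : Integrable G
  weakGradient : HasWeakGradient u G

/-- `l` is the limit, as `r → 0⁺`, of the averages of `u` over the balls `B(x, r)`. -/
def IsLimitOfAverages {d : ℕ} (u : EuclideanSpace ℝ (Fin d) → ℝ) (x : EuclideanSpace ℝ (Fin d))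
    (l : ℝ) : Prop :=
  Tendsto (fun r : ℝ => ⨍ y in Metric.ball x r, u y) (𝓝[>] 0) (𝓝 l)

open Classical in
/-- The precise representative of `u`: the limit of the averages of `u` over `B(x, r)` as `r → 0⁺`
where that limit exists (in `ℝ`), and `0` elsewhere. It depends only on the Lebesgue-a.e. class of
`u`, and agrees with `u` everywhere if `u` is continuous. -/
def preciseRep {d : ℕ} (u : EuclideanSpace ℝ (Fin d) → ℝ) (x : EuclideanSpace ℝ (Fin d)) : ℝ :=
  if h : ∃ l, IsLimitOfAverages u x l then h.choose else 0

/-- The Lorentz quasi-norm, for `1 < p < ∞` and `1 ≤ r < ∞`, with values in `[0, ∞]`: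
`‖f‖_{L^{p,r}} = (p ∫₀^∞ (t |{|f| > t}|^{1/p})^r dt/t)^{1/r}`. -/
def lorentzNorm {d : ℕ} (p r : ℝ) (f : EuclideanSpace ℝ (Fin d) → ℝ) : ℝ≥0∞ :=
  (ENNReal.ofReal p * ∫⁻ t in Ioi (0 : ℝ),
    (ENNReal.ofReal t * (volume {x | t < |f x|}) ^ (1 / p)) ^ r / ENNReal.ofReal t) ^ (1 / r)

end

/-! ### Poincaré inequality on balls. -/

section Poincare

variable {E : Type*} [NormedAddCommGroup E] [NormedSpace ℝ E]

/-! Everything rests on one boxing inequality for outer measures. Let `Φ` be an outer measure with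
Φ(B(x,r)) ≤ K r^(d-1). For v of class C¹ and a level t > 0, each point of {v > t} is the centre of a
ball in which this set and its complement both have a substantial share. The relative isoperimetric
inequality, obtained from Poincaré applied to smoothed indicators, bounds r^(d-1) by the perimeter
inside the ball. A Vitali covering then bounds Φ{v > t} by K times the perimeter
(`outerMeasure_superlevel_le_levelVariation`), and integrating in t with the coarea inequality gives
∫ Φ{|v| > t} dt ≤ C K ∫ |∇v|. Perimeter is replaced by `levelVariation`, so no BV theory is needed.

Mollification carries this to W^{1,1} when Φ vanishes on Lebesgue-null sets and is continuous along
increasing unions (`lintegral_outerMeasure_superlevel_le_of_approx`). Taking Φ(A) = |A|^((d-1)/d)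
gives Alvino's inequality, hence Gagliardo–Nirenberg; Φ = dx/|x| gives Hardy's.

For the trace inequality, μ itself may charge Lebesgue-null sets. The right choice is Φ(A) = ∫ M1_A
dμ with M a maximal operator: it ignores null sets and inherits the growth of μ on balls. The
outcome, ∫ M|u| dμ ≤ C K ∫ |∇u| (`exists_lintegral_dyadicMaximal_le`), bounds the precise
representative; applied to u minus its mollifications, it also makes the ball averages Cauchy at
μ-almost every point. -/

theorem enorm_sub_le_lintegral_fderiv_segment {v : E → ℝ} (hv : ContDiff ℝ 1 v) (x y : E) :
    ‖v x - v y‖ₑ ≤ ‖y - x‖ₑ * ∫⁻ s in Ioc (0 : ℝ) 1, ‖fderiv ℝ v (x + s • (y - x))‖ₑ := by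
  have hcont : Continuous fun s : ℝ => fderiv ℝ v (x + s • (y - x)) :=
    (hv.continuous_fderiv one_ne_zero).comp (by fun_prop)
  have hderiv : ∀ s ∈ uIcc (0 : ℝ) 1, HasDerivAt (fun s : ℝ => v (x + s • (y - x)))
      (fderiv ℝ v (x + s • (y - x)) (y - x)) s := by
    intro s _
    have h1 : HasDerivAt (fun s : ℝ => x + s • (y - x)) (y - x) s := by
      simpa using ((hasDerivAt_id s).smul_const (y - x)).const_add x
    exact ((hv.differentiable one_ne_zero _).hasFDerivAt).comp_hasDerivAt s h1
  have hftc := intervalIntegral.integral_eq_sub_of_hasDerivAt hderiv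
    ((hcont.clm_apply continuous_const).intervalIntegrable _ _)
  simp only [one_smul, add_sub_cancel, zero_smul, add_zero] at hftc
  rw [enorm_sub_rev, ← hftc, intervalIntegral.integral_of_le zero_le_one]
  refine (enorm_integral_le_lintegral_enorm _).trans ?_
  rw [← lintegral_const_mul' _ _ enorm_ne_top]
  refine lintegral_mono fun s => ?_
  rw [mul_comm]
  exact ContinuousLinearMap.le_opENorm _ _

variable [MeasurableSpace E] [BorelSpace E] [FiniteDimensional ℝ E]
  (ν : Measure E) [ν.IsAddHaarMeasure]

theorem lintegral_comp_add_smul (f : E → ℝ≥0∞) (a : E) {s : ℝ} (hs : s ≠ 0) :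
    ∫⁻ y, f (a + s • y) ∂ν = ENNReal.ofReal |(s ^ Module.finrank ℝ E)⁻¹| * ∫⁻ y, f y ∂ν := by
  have h1 : ∫⁻ y, f (a + s • y) ∂ν = ∫⁻ y, f (a + y) ∂(Measure.map (s • ·) ν) :=
    ((Homeomorph.smulOfNeZero s hs).measurableEmbedding.lintegral_map
      (fun y => f (a + y))).symm
  rw [h1, Measure.map_addHaar_smul ν hs, lintegral_smul_measure,
    lintegral_add_left_eq_self (fun y => f y) a, smul_eq_mul]

theorem lintegral_comp_add_smul_le (f : E → ℝ≥0∞) (a : E) {s : ℝ} (hs : 1 / 2 ≤ s) :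
    ∫⁻ y, f (a + s • y) ∂ν ≤ 2 ^ Module.finrank ℝ E * ∫⁻ y, f y ∂ν := by
  have hs0 : 0 < s := by linarith
  rw [lintegral_comp_add_smul ν f a hs0.ne']
  gcongr
  rw [abs_of_pos (by positivity), ← inv_pow, ENNReal.ofReal_pow (by positivity)]
  gcongr
  rw [← ENNReal.ofReal_ofNat 2]
  refine ENNReal.ofReal_le_ofReal ?_
  rw [inv_le_comm₀ hs0 two_pos]
  linarith

/-- In (1 - s)x + s y one of the two coefficients is at least 1/2. Integrating first in that
variable costs at most a factor 2^n by dilation, and the other variable contributes ν B. -/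
theorem setLIntegral_setLIntegral_segment_le {g : E → ℝ≥0∞} (hg : Measurable g) (B : Set E)
    (s : ℝ) :
    ∫⁻ x in B, ∫⁻ y in B, g (x + s • (y - x)) ∂ν ∂ν
      ≤ 2 ^ Module.finrank ℝ E * ν B * ∫⁻ z, g z ∂ν := by
  have key : ∀ s : ℝ, 1 / 2 ≤ s → ∫⁻ x in B, ∫⁻ y in B, g ((1 - s) • x + s • y) ∂ν ∂ν
      ≤ 2 ^ Module.finrank ℝ E * ν B * ∫⁻ z, g z ∂ν := by
    intro s hs
    calc ∫⁻ x in B, ∫⁻ y in B, g ((1 - s) • x + s • y) ∂ν ∂ν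
        ≤ ∫⁻ x in B, 2 ^ Module.finrank ℝ E * ∫⁻ z, g z ∂ν ∂ν :=
          lintegral_mono fun x => (setLIntegral_le_lintegral _ _).trans
            (lintegral_comp_add_smul_le ν g _ hs)
      _ = 2 ^ Module.finrank ℝ E * ν B * ∫⁻ z, g z ∂ν := by
          rw [setLIntegral_const]; ring
  have hrw : ∀ x y : E, x + s • (y - x) = (1 - s) • x + s • y := by
    intro x y; module
  simp only [hrw]
  rcases le_total (1 / 2) s with hs | hs
  · exact key s hs
  · rw [lintegral_lintegral_swap (by fun_prop)]
    refine le_trans (le_of_eq ?_) (key (1 - s) (by linarith))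
    simp only [sub_sub_cancel, add_comm]

/-- Poincaré in double-integral form. Segments between points of the ball stay in it, so the
gradient can be cut off outside; Tonelli then reduces to a bound uniform in the position s along the
segment. -/
theorem lintegral_lintegral_enorm_sub_le {v : E → ℝ} (hv : ContDiff ℝ 1 v) (x₀ : E) (r : ℝ) :
    ∫⁻ x in Metric.ball x₀ r, ∫⁻ y in Metric.ball x₀ r, ‖v x - v y‖ₑ ∂ν ∂ν
      ≤ ENNReal.ofReal (2 * r) * (2 ^ Module.finrank ℝ E * ν (Metric.ball x₀ r) *
        ∫⁻ z in Metric.ball x₀ r, ‖fderiv ℝ v z‖ₑ ∂ν) := by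
  set B := Metric.ball x₀ r with hB
  have hBm : MeasurableSet B := Metric.isOpen_ball.measurableSet
  set g : E → ℝ≥0∞ := B.indicator fun z => ‖fderiv ℝ v z‖ₑ with hg
  have hgm : Measurable g :=
    ((hv.continuous_fderiv one_ne_zero).enorm.measurable).indicator hBm
  have hpt : ∀ x ∈ B, ∀ y ∈ B, ‖v x - v y‖ₑ ≤
      ENNReal.ofReal (2 * r) * ∫⁻ s in Ioc (0 : ℝ) 1, g (x + s • (y - x)) := by
    intro x hx y hy
    refine (enorm_sub_le_lintegral_fderiv_segment hv x y).trans ?_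
    refine mul_le_mul' ?_ (le_of_eq ?_)
    · rw [← ofReal_norm]
      refine ENNReal.ofReal_le_ofReal ?_
      rw [← dist_eq_norm]
      have := dist_triangle_right y x x₀
      rw [hB, Metric.mem_ball] at hx hy
      linarith
    · refine setLIntegral_congr_fun measurableSet_Ioc fun s hs => ?_
      have : x + s • (y - x) ∈ B :=
        (convex_ball x₀ r).add_smul_sub_mem hx hy ⟨hs.1.le, hs.2⟩
      simp [hg, this]
  calc ∫⁻ x in B, ∫⁻ y in B, ‖v x - v y‖ₑ ∂ν ∂ν
      ≤ ∫⁻ x in B, ∫⁻ y in B, ENNReal.ofReal (2 * r) *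
          (∫⁻ s in Ioc (0 : ℝ) 1, g (x + s • (y - x))) ∂ν ∂ν :=
        setLIntegral_mono' hBm fun x hx => setLIntegral_mono' hBm fun y hy => hpt x hx y hy
    _ = ENNReal.ofReal (2 * r) * ∫⁻ s in Ioc (0 : ℝ) 1, ∫⁻ x in B, ∫⁻ y in B,
          g (x + s • (y - x)) ∂ν ∂ν := by
        have h1 : ∀ x, ∫⁻ y in B, ENNReal.ofReal (2 * r) *
            (∫⁻ s in Ioc (0 : ℝ) 1, g (x + s • (y - x))) ∂ν = ENNReal.ofReal (2 * r) *
            ∫⁻ s in Ioc (0 : ℝ) 1, ∫⁻ y in B, g (x + s • (y - x)) ∂ν := by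
          intro x
          rw [lintegral_const_mul' _ _ ENNReal.ofReal_ne_top, lintegral_lintegral_swap]
          exact (hgm.comp (by fun_prop)).aemeasurable
        simp only [h1]
        rw [lintegral_const_mul' _ _ ENNReal.ofReal_ne_top, lintegral_lintegral_swap]
        have : Measurable fun p : (E × ℝ) × E => g (p.1.1 + p.1.2 • (p.2 - p.1.1)) :=
          hgm.comp (by fun_prop)
        exact this.lintegral_prod_right'.aemeasurable
    _ ≤ ENNReal.ofReal (2 * r) * ∫⁻ _ in Ioc (0 : ℝ) 1,
          2 ^ Module.finrank ℝ E * ν B * ∫⁻ z, g z ∂ν := by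
        gcongr with s
        exact setLIntegral_setLIntegral_segment_le ν hgm B s
    _ = _ := by
        rw [setLIntegral_const, Real.volume_Ioc, hg, lintegral_indicator hBm]
        simp

end Poincare

/-! ### Coarea, relative isoperimetry and boxing for C¹ functions. -/

section Boxing

/-- The lower limit, as `n → ∞`, of the total variations of the smoothed indicator functions
`ψ (n (v - t))` of the superlevel set `{t < v}`. It plays the role of the perimeter of this set. -/
noncomputable def levelVariation {E : Type*} [NormedAddCommGroup E] [NormedSpace ℝ E]
    [MeasurableSpace E] (ν : Measure E) (v : E → ℝ) (t : ℝ) : ℝ≥0∞ :=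
  liminf (fun n : ℕ => ∫⁻ x, ‖(n : ℝ) * deriv Real.smoothTransition (n * (v x - t))‖ₑ *
    ‖fderiv ℝ v x‖ₑ ∂ν) atTop

theorem continuous_deriv_smoothTransition : Continuous (deriv Real.smoothTransition) :=
  (Real.smoothTransition.contDiff (n := 1)).continuous_deriv le_rfl

theorem lintegral_enorm_deriv_smoothTransition_ne_top :
    ∫⁻ s, ‖deriv Real.smoothTransition s‖ₑ ≠ ⊤ := by
  have hsupp : HasCompactSupport (deriv Real.smoothTransition) := by
    refine HasCompactSupport.intro (isCompact_Icc (a := (0 : ℝ)) (b := 1)) fun s hs => ?_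
    rw [mem_Icc, not_and_or, not_le, not_le] at hs
    rcases hs with hs | hs
    · have : Real.smoothTransition =ᶠ[𝓝 s] fun _ => 0 := by
        filter_upwards [eventually_lt_nhds hs] with z hz
        exact Real.smoothTransition.zero_of_nonpos hz.le
      rw [this.deriv_eq, deriv_const]
    · have : Real.smoothTransition =ᶠ[𝓝 s] fun _ => 1 := by
        filter_upwards [eventually_gt_nhds hs] with z hz
        exact Real.smoothTransition.one_of_one_le hz.le
      rw [this.deriv_eq, deriv_const]
  exact (continuous_deriv_smoothTransition.integrable_of_hasCompactSupport hsupp).2.ne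

/-- Fatou for the counting measure; it makes `levelVariation` superadditive over disjoint balls. -/
theorem tsum_liminf_le {ι : Type*} (a : ι → ℕ → ℝ≥0∞) :
    ∑' i, liminf (a i) atTop ≤ liminf (fun n => ∑' i, a i n) atTop := by
  let _ : MeasurableSpace ι := ⊤
  simp only [← lintegral_count]
  exact lintegral_liminf_le fun n => measurable_from_top

theorem enorm_fderiv_smoothTransition_comp {E : Type*} [NormedAddCommGroup E]
    [NormedSpace ℝ E] {v : E → ℝ} (hv : ContDiff ℝ 1 v) (a t : ℝ) (x : E) :
    ‖fderiv ℝ (fun x => Real.smoothTransition (a * (v x - t))) x‖ₑ =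
      ‖a * deriv Real.smoothTransition (a * (v x - t))‖ₑ * ‖fderiv ℝ v x‖ₑ := by
  have h1 : HasFDerivAt (fun x => a * (v x - t)) (a • fderiv ℝ v x) x :=
    (((hv.differentiable one_ne_zero x).hasFDerivAt).sub_const t).const_mul a
  have h2 : HasDerivAt Real.smoothTransition
      (deriv Real.smoothTransition (a * (v x - t))) (a * (v x - t)) :=
    ((Real.smoothTransition.contDiff (n := 1)).differentiable one_ne_zero _).hasDerivAt
  have h3 := (h2.comp_hasFDerivAt x h1).fderiv
  rw [Function.comp_def] at h3
  rw [h3, smul_smul, enorm_smul, mul_comm (deriv _ _)]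

/-- When v y ≤ t < v x, the smoothed indicators are exactly 1 at x and 0 at y once n(v x - t) ≥ 1.
-/
theorem indicator_mul_indicator_compl_le_liminf {α : Type*} (v : α → ℝ) (t : ℝ) (x y : α) :
    {x | t < v x}.indicator (fun _ => (1 : ℝ≥0∞)) x * {x | t < v x}ᶜ.indicator (fun _ => 1) y ≤
      liminf (fun n : ℕ => ‖Real.smoothTransition (n * (v x - t)) -
        Real.smoothTransition (n * (v y - t))‖ₑ) atTop := by
  by_cases hx : t < v x
  swap; · simp [hx]
  by_cases hy : t < v y
  · simp [hy]
  have hx' : 0 < v x - t := sub_pos.2 hx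
  have hy' : v y - t ≤ 0 := sub_nonpos.2 (not_lt.1 hy)
  obtain ⟨N, hN⟩ := exists_nat_ge (1 / (v x - t))
  refine le_liminf_of_le (by isBoundedDefault) ?_
  filter_upwards [eventually_ge_atTop N] with n hn
  have h1 : Real.smoothTransition (n * (v x - t)) = 1 := by
    refine Real.smoothTransition.one_of_one_le ?_
    rw [← div_le_iff₀ hx']
    exact hN.trans (by exact_mod_cast hn)
  have h2 : Real.smoothTransition (n * (v y - t)) = 0 :=
    Real.smoothTransition.zero_of_nonpos (mul_nonpos_of_nonneg_of_nonpos (by positivity) hy')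
  simp [hx, hy, h1, h2]

variable {E : Type*} [NormedAddCommGroup E] [NormedSpace ℝ E]
  [MeasurableSpace E] [BorelSpace E] [FiniteDimensional ℝ E]
  (ν : Measure E)

/-- The half of the coarea formula that is needed. For fixed x the substitution s = n(v x - t)
bounds the t-integral by the L¹ norm of the derivative of the transition, whatever n; Fatou takes
the lower limit outside. -/
theorem lintegral_levelVariation_le [SFinite ν] {v : E → ℝ} (hv : ContDiff ℝ 1 v) :
    ∫⁻ t, levelVariation ν v t ≤
      (∫⁻ s, ‖deriv Real.smoothTransition s‖ₑ) * ∫⁻ x, ‖fderiv ℝ v x‖ₑ ∂ν := by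
  have hDv : Continuous fun x => ‖fderiv ℝ v x‖ₑ := (hv.continuous_fderiv one_ne_zero).enorm
  have hcont : ∀ n : ℕ, Continuous fun p : ℝ × E =>
      ‖(n : ℝ) * deriv Real.smoothTransition (n * (v p.2 - p.1))‖ₑ := fun n =>
    (continuous_const.mul (continuous_deriv_smoothTransition.comp
      (continuous_const.mul ((hv.continuous.comp continuous_snd).sub continuous_fst)))).enorm
  have hmeas : ∀ n : ℕ, Measurable fun p : ℝ × E =>
      ‖(n : ℝ) * deriv Real.smoothTransition (n * (v p.2 - p.1))‖ₑ * ‖fderiv ℝ v p.2‖ₑ := fun n =>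
    (hcont n).measurable.mul (hDv.measurable.comp measurable_snd)
  have hone : ∀ n : ℕ, ∀ a : ℝ, ∫⁻ t, ‖(n : ℝ) * deriv Real.smoothTransition (n * (a - t))‖ₑ
      ≤ ∫⁻ s, ‖deriv Real.smoothTransition s‖ₑ := by
    intro n a
    rcases Nat.eq_zero_or_pos n with rfl | hn
    · simp
    have hn' : (0 : ℝ) < n := by exact_mod_cast hn
    have h1 : ∀ t : ℝ, ‖(n : ℝ) * deriv Real.smoothTransition (n * (a - t))‖ₑ =
        ENNReal.ofReal n * ‖deriv Real.smoothTransition (n * a + (-n : ℝ) • t)‖ₑ := by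
      intro t
      rw [enorm_mul, Real.enorm_of_nonneg hn'.le, smul_eq_mul]
      congr 3
      ring
    simp only [h1]
    rw [lintegral_const_mul' _ _ ENNReal.ofReal_ne_top,
      lintegral_comp_add_smul volume (fun y => ‖deriv Real.smoothTransition y‖ₑ) _
        (neg_ne_zero.2 hn'.ne'), ← mul_assoc, ← ENNReal.ofReal_mul hn'.le]
    simp [hn'.ne']
  calc ∫⁻ t, levelVariation ν v t
      ≤ liminf (fun n : ℕ => ∫⁻ t, ∫⁻ x, ‖(n : ℝ) * deriv Real.smoothTransition (n * (v x - t))‖ₑ *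
        ‖fderiv ℝ v x‖ₑ ∂ν) atTop :=
        lintegral_liminf_le fun n => (hmeas n).lintegral_prod_right'
    _ ≤ liminf (fun _ : ℕ => (∫⁻ s, ‖deriv Real.smoothTransition s‖ₑ) *
          ∫⁻ x, ‖fderiv ℝ v x‖ₑ ∂ν) atTop := by
        refine liminf_le_liminf (Eventually.of_forall fun n => ?_)
        rw [lintegral_lintegral_swap (hmeas n).aemeasurable,
          ← lintegral_const_mul _ hDv.measurable]
        refine lintegral_mono fun x => ?_
        dsimp only
        rw [lintegral_mul_const' _ _ enorm_ne_top]
        exact mul_le_mul_left (hone n (v x)) _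
    _ = _ := by simp

variable [ν.IsAddHaarMeasure]

/-- Relative isoperimetric inequality: Poincaré for the smoothed indicators of the superlevel set,
with Fatou in both variables. -/
theorem measure_inter_mul_measure_diff_le_levelVariation {v : E → ℝ} (hv : ContDiff ℝ 1 v)
    (t : ℝ) (x₀ : E) (r : ℝ) :
    ν (Metric.ball x₀ r ∩ {x | t < v x}) * ν (Metric.ball x₀ r \ {x | t < v x}) ≤
      ENNReal.ofReal (2 * r) * (2 ^ Module.finrank ℝ E * ν (Metric.ball x₀ r)) *
        levelVariation (ν.restrict (Metric.ball x₀ r)) v t := by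
  generalize hB : Metric.ball x₀ r = B
  set S := {x | t < v x}
  have hSm : MeasurableSet S := measurableSet_lt measurable_const hv.continuous.measurable
  set w : ℕ → E → ℝ := fun n x => Real.smoothTransition (n * (v x - t)) with hw
  have hwc : ∀ n, ContDiff ℝ 1 (w n) := fun n =>
    Real.smoothTransition.contDiff.comp (contDiff_const.mul (hv.sub contDiff_const))
  have hlim : ∀ x y, S.indicator (fun _ => (1 : ℝ≥0∞)) x * Sᶜ.indicator (fun _ => 1) y ≤
      liminf (fun n => ‖w n x - w n y‖ₑ) atTop := indicator_mul_indicator_compl_le_liminf v t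
  have hm2 : ∀ n, Measurable fun p : E × E => ‖w n p.1 - w n p.2‖ₑ := fun n =>
    (((hwc n).continuous.comp continuous_fst).sub
      ((hwc n).continuous.comp continuous_snd)).enorm.measurable
  calc ν (B ∩ S) * ν (B \ S)
      = ∫⁻ x in B, ∫⁻ y in B, S.indicator (fun _ => (1 : ℝ≥0∞)) x *
          Sᶜ.indicator (fun _ => 1) y ∂ν ∂ν := by
        have h1 : ∀ x, ∫⁻ y in B, S.indicator (fun _ => (1 : ℝ≥0∞)) x *
          Sᶜ.indicator (fun _ => 1) y ∂ν = S.indicator (fun _ => (1 : ℝ≥0∞)) x * ν (B \ S) := by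
          intro x
          rw [lintegral_const_mul _ (measurable_const.indicator hSm.compl),
            lintegral_indicator hSm.compl, setLIntegral_one, Measure.restrict_apply hSm.compl,
            inter_comm, sdiff_eq]
        simp only [h1]
        rw [lintegral_mul_const _ (measurable_const.indicator hSm), lintegral_indicator hSm,
          setLIntegral_one, Measure.restrict_apply hSm, inter_comm]
    _ ≤ ∫⁻ x in B, ∫⁻ y in B, liminf (fun n => ‖w n x - w n y‖ₑ) atTop ∂ν ∂ν :=
        lintegral_mono fun x => lintegral_mono fun y => hlim x y
    _ ≤ ∫⁻ x in B, liminf (fun n => ∫⁻ y in B, ‖w n x - w n y‖ₑ ∂ν) atTop ∂ν :=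
        lintegral_mono fun x => lintegral_liminf_le fun n =>
          ((hwc n).continuous.measurable.const_sub (w n x)).enorm
    _ ≤ liminf (fun n => ∫⁻ x in B, ∫⁻ y in B, ‖w n x - w n y‖ₑ ∂ν ∂ν) atTop :=
        lintegral_liminf_le fun n => (hm2 n).lintegral_prod_right'
    _ ≤ liminf (fun n : ℕ => ENNReal.ofReal (2 * r) * (2 ^ Module.finrank ℝ E * ν B) *
          ∫⁻ x in B, ‖(n : ℝ) * deriv Real.smoothTransition (n * (v x - t))‖ₑ *
            ‖fderiv ℝ v x‖ₑ ∂ν) atTop := by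
        refine liminf_le_liminf (Eventually.of_forall fun n => ?_)
        have hpoin := lintegral_lintegral_enorm_sub_le ν (hwc n) x₀ r
        rw [hB] at hpoin
        refine hpoin.trans (le_of_eq ?_)
        simp only [hw, enorm_fderiv_smoothTransition_comp hv]
        ring
    _ = _ := by
        have hBt : ν B ≠ ⊤ := hB ▸ measure_ball_lt_top.ne
        have hct : ENNReal.ofReal (2 * r) * (2 ^ Module.finrank ℝ E * ν B) ≠ ⊤ :=
          ENNReal.mul_ne_top ENNReal.ofReal_ne_top (ENNReal.mul_ne_top (by simp) hBt)
        rw [levelVariation, ENNReal.liminf_const_mul_of_ne_top hct]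

variable [Nontrivial E]

/-- Double the radius, starting from a ball inside S, until S first fills less than half of the
ball; this happens because ν S is finite while the volumes tend to infinity. One doubling earlier S
filled at least half, so it still fills a 2^-(n+1) share. -/
theorem exists_ball_density {S : Set E} (hS : IsOpen S) (hfin : ν S < ⊤) {x : E} (hx : x ∈ S) :
    ∃ r : ℝ, 0 < r ∧
      ν (Metric.ball x r) ≤ 2 ^ (Module.finrank ℝ E + 1) * ν (Metric.ball x r ∩ S) ∧
      ν (Metric.ball x r) ≤ 2 * ν (Metric.ball x r \ S) := by
  obtain ⟨r₀, hr₀, hsub⟩ := Metric.isOpen_iff.1 hS x hx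
  have hn : 0 < Module.finrank ℝ E := Module.finrank_pos
  have hdouble : ∀ r : ℝ, 0 ≤ r → ν (Metric.ball x (2 * r)) =
      2 ^ Module.finrank ℝ E * ν (Metric.ball x r) := by
    intro r hr
    rw [Measure.addHaar_ball ν x (by positivity), Measure.addHaar_ball ν x hr, mul_pow,
      ENNReal.ofReal_mul (by positivity), ENNReal.ofReal_pow (by positivity), mul_assoc]
    simp
  have hex : ∃ k : ℕ, 2 * ν (Metric.ball x (2 ^ k * r₀) ∩ S) < ν (Metric.ball x (2 ^ k * r₀)) := by
    have hlim : Tendsto (fun k : ℕ => (2 : ℝ≥0∞) ^ k * ν (Metric.ball x r₀)) atTop (𝓝 ⊤) := by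
      have h2 := ENNReal.tendsto_pow_atTop_nhds_top_iff.2 (ENNReal.one_lt_two)
      have := ENNReal.Tendsto.mul_const (b := ν (Metric.ball x r₀)) h2 (Or.inl (by simp))
      rwa [ENNReal.top_mul (Metric.measure_ball_pos ν _ hr₀).ne'] at this
    obtain ⟨k, hk⟩ := (hlim.eventually (lt_mem_nhds
      (ENNReal.mul_lt_top ENNReal.ofNat_lt_top hfin : 2 * ν S < ⊤))).exists
    refine ⟨k, lt_of_le_of_lt (by gcongr; exact inter_subset_right) (hk.trans_le ?_)⟩
    have : ∀ k : ℕ, (2 : ℝ≥0∞) ^ k * ν (Metric.ball x r₀) ≤ ν (Metric.ball x (2 ^ k * r₀)) := by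
      intro k
      induction k with
      | zero => simp
      | succ k ih =>
        rw [pow_succ', pow_succ', mul_assoc, mul_assoc, hdouble _ (by positivity)]
        gcongr
        exact le_self_pow₀ one_le_two hn.ne'
    exact this k
  classical
  set k := Nat.find hex with hk
  have hk1 := Nat.find_spec hex
  -- The starting ball lies in S, so the stopping index has a predecessor.
  have hk0 : k ≠ 0 := by
    intro h0
    rw [← hk, h0, pow_zero, one_mul, inter_eq_left.2 hsub] at hk1
    exact absurd hk1 (not_lt.2 (le_mul_of_one_le_left' one_le_two))
  obtain ⟨m, hm⟩ := Nat.exists_eq_succ_of_ne_zero hk0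
  have hm1 := Nat.find_min hex (m := m) (by omega)
  rw [not_lt] at hm1
  rw [← hk, hm] at hk1
  have hrm : (2 : ℝ) ^ (m + 1) * r₀ = 2 * (2 ^ m * r₀) := by ring
  rw [Nat.succ_eq_add_one, hrm] at hk1
  refine ⟨2 * (2 ^ m * r₀), by positivity, ?_, ?_⟩
  · rw [hdouble _ (by positivity), pow_succ, mul_assoc]
    gcongr
    have hpos : 0 ≤ (2 : ℝ) ^ m * r₀ := by positivity
    exact hm1.trans (mul_le_mul_right (measure_mono (inter_subset_inter_left _
      (Metric.ball_subset_ball (by linarith)))) _)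
  · set B := Metric.ball x (2 * (2 ^ m * r₀))
    have hadd : ν (B ∩ S) + ν (B \ S) = ν B := measure_inter_add_sdiff B hS.measurableSet
    by_contra! hcon
    have : 2 * ν B < 2 * ν B := by
      calc 2 * ν B = 2 * ν (B ∩ S) + 2 * ν (B \ S) := by rw [← hadd, mul_add]
        _ < ν B + ν B := ENNReal.add_lt_add hk1 hcon
        _ = 2 * ν B := (two_mul _).symm
    exact lt_irrefl _ this

/-- In the ball of balanced density both factors of the isoperimetric inequality are comparable to ν
B. Cancelling one ν B, then one r from ν B = κ rⁿ, leaves r^(n-1). The volume bound is kept to bound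
the radii in the Vitali covering. -/
theorem exists_ball_pow_le_levelVariation {v : E → ℝ} (hv : ContDiff ℝ 1 v) {t : ℝ}
    (hfin : ν {x | t < v x} < ⊤) {x : E} (hx : t < v x) :
    ∃ r : ℝ, 0 < r ∧
      ν (Metric.ball x r) ≤ 2 ^ (Module.finrank ℝ E + 1) * ν {x | t < v x} ∧
      ENNReal.ofReal (r ^ (Module.finrank ℝ E - 1)) ≤
        2 ^ (2 * Module.finrank ℝ E + 3) / ν (Metric.ball 0 1) *
          levelVariation (ν.restrict (Metric.ball x r)) v t := by
  have hSo : IsOpen {x | t < v x} := isOpen_lt continuous_const hv.continuous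
  obtain ⟨r, hr, h1, h2⟩ := exists_ball_density ν hSo hfin hx
  refine ⟨r, hr, h1.trans (by gcongr; exact inter_subset_right), ?_⟩
  have hiso := measure_inter_mul_measure_diff_le_levelVariation ν hv t x r
  set n := Module.finrank ℝ E with hn
  have hn0 : 0 < n := Module.finrank_pos
  set V := levelVariation (ν.restrict (Metric.ball x r)) v t
  set b := ν (Metric.ball x r) with hb
  have hb0 : b ≠ 0 := (Metric.measure_ball_pos ν _ hr).ne'
  have hbt : b ≠ ⊤ := measure_ball_lt_top.ne
  set κ := ν (Metric.ball (0 : E) 1) with hκ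
  have hκ0 : κ ≠ 0 := (Metric.measure_ball_pos ν _ one_pos).ne'
  have hκt : κ ≠ ⊤ := measure_ball_lt_top.ne
  have hbr : b = ENNReal.ofReal r * (ENNReal.ofReal (r ^ (n - 1)) * κ) := by
    rw [hb, Measure.addHaar_ball ν x hr.le, ← mul_assoc, ← ENNReal.ofReal_mul hr.le,
      ← pow_succ', Nat.sub_add_cancel hn0]
  have hbb : b * b ≤ b * (ENNReal.ofReal r * (2 ^ (2 * n + 3) * V)) := by
    calc b * b ≤ (2 ^ (n + 1) * ν (Metric.ball x r ∩ {x | t < v x})) *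
          (2 * ν (Metric.ball x r \ {x | t < v x})) := mul_le_mul' h1 h2
      _ = 2 ^ (n + 2) * (ν (Metric.ball x r ∩ {x | t < v x}) *
          ν (Metric.ball x r \ {x | t < v x})) := by ring
      _ ≤ 2 ^ (n + 2) * (ENNReal.ofReal (2 * r) * (2 ^ n * b) * V) := by gcongr
      _ = _ := by
        rw [ENNReal.ofReal_mul two_pos.le, ENNReal.ofReal_ofNat]; ring
  rw [ENNReal.mul_le_mul_iff_right hb0 hbt] at hbb
  nth_rw 1 [hbr] at hbb
  rw [ENNReal.mul_le_mul_iff_right (by simpa using hr) ENNReal.ofReal_ne_top] at hbb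
  rw [div_eq_mul_inv, mul_right_comm, ← div_eq_mul_inv,
    ENNReal.le_div_iff_mul_le (Or.inl hκ0) (Or.inl hκt)]
  exact hbb

/-- The boxing inequality. -/
theorem outerMeasure_superlevel_le_levelVariation (Φ : OuterMeasure E) {K : ℝ≥0∞}
    (hΦ : ∀ (x : E) (r : ℝ), 0 < r →
      Φ (Metric.ball x r) ≤ K * ENNReal.ofReal (r ^ (Module.finrank ℝ E - 1)))
    {v : E → ℝ} (hv : ContDiff ℝ 1 v) {t : ℝ} (hfin : ν {x | t < v x} < ⊤) :
    Φ {x | t < v x} ≤ 6 ^ (Module.finrank ℝ E - 1) *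
      (2 ^ (2 * Module.finrank ℝ E + 3) / ν (Metric.ball 0 1)) * K * levelVariation ν v t := by
  set S := {x | t < v x} with hS
  set n := Module.finrank ℝ E with hn
  have hn0 : n ≠ 0 := (Module.finrank_pos (R := ℝ) (M := E)).ne'
  set c : ℝ≥0∞ := 2 ^ (2 * n + 3) / ν (Metric.ball 0 1) with hc
  choose! ρ hρ0 hρS hρV using
    fun x (hx : x ∈ S) => exists_ball_pow_le_levelVariation ν hv hfin hx
  have hκ0 : ν (Metric.ball (0 : E) 1) ≠ 0 := (Metric.measure_ball_pos ν _ one_pos).ne'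
  -- Vitali needs bounded radii: ρⁿ is bounded through ν S, and ρ ≤ ρⁿ when ρ ≥ 1, whence the
  -- maximum with 1.
  obtain ⟨R, hR⟩ : ∃ R, ∀ x ∈ S, ρ x ≤ R := by
    set A : ℝ≥0∞ := 2 ^ (n + 1) * ν S / ν (Metric.ball 0 1) with hA
    have hAt : A ≠ ⊤ :=
      (ENNReal.div_lt_top (ENNReal.mul_ne_top (by simp) hfin.ne) hκ0).ne
    refine ⟨max 1 A.toReal, fun x hx => ?_⟩
    by_contra! hcon
    have h1 : 1 ≤ ρ x := (le_max_left _ _).trans hcon.le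
    have h2 := hρS x hx
    rw [Measure.addHaar_ball ν x (hρ0 x hx).le, ← ENNReal.le_div_iff_mul_le (Or.inl hκ0)
      (Or.inl measure_ball_lt_top.ne), ← hA, ENNReal.ofReal_le_iff_le_toReal hAt] at h2
    have h3 : ρ x ≤ ρ x ^ n := le_self_pow₀ h1 hn0
    exact absurd (h3.trans h2) (not_le.2 ((le_max_right _ _).trans_lt hcon))
  obtain ⟨U, hUS, hUd, hU⟩ := Vitali.exists_disjoint_subfamily_covering_enlargement_closedBall
    S id ρ R hR 5 (by norm_num)
  simp only [id] at hUd hU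
  have hdisj : U.PairwiseDisjoint fun x => Metric.ball x (ρ x) :=
    hUd.mono fun x => Metric.ball_subset_closedBall
  have hUc : U.Countable := hdisj.countable_of_isOpen (fun _ _ => Metric.isOpen_ball)
    fun x hx => Metric.nonempty_ball.2 (hρ0 x (hUS hx))
  have : Countable U := hUc.to_subtype
  -- Vitali gives closed balls enlarged 5 times; the factor 6 passes to open balls, where `hΦ`
  -- applies.
  have hcover : S ⊆ ⋃ y : U, Metric.ball (y : E) (6 * ρ y) := by
    intro x hx
    obtain ⟨y, hy, hxy⟩ := hU x hx
    have h0 := hρ0 y (hUS hy)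
    exact mem_iUnion.2 ⟨⟨y, hy⟩, Metric.closedBall_subset_ball (by linarith)
      (hxy (Metric.mem_closedBall_self (hρ0 x hx).le))⟩
  have hsum : ∑' y : U, levelVariation (ν.restrict (Metric.ball (y : E) (ρ y))) v t ≤
      levelVariation ν v t := by
    refine (tsum_liminf_le _).trans (liminf_le_liminf (Eventually.of_forall fun k => ?_))
    rw [← lintegral_iUnion (s := fun y : U => Metric.ball (y : E) (ρ y))
      (fun _ => Metric.isOpen_ball.measurableSet)
      (fun x y hxy => hdisj x.2 y.2 (fun h => hxy (Subtype.ext h)))]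
    exact setLIntegral_le_lintegral _ _
  calc Φ S ≤ Φ (⋃ y : U, Metric.ball (y : E) (6 * ρ y)) := measure_mono hcover
    _ ≤ ∑' y : U, Φ (Metric.ball (y : E) (6 * ρ y)) := measure_iUnion_le _
    _ ≤ ∑' y : U, 6 ^ (n - 1) * c * K *
          levelVariation (ν.restrict (Metric.ball (y : E) (ρ y))) v t := by
        refine ENNReal.tsum_le_tsum fun y => ?_
        have h0 := hρ0 y (hUS y.2)
        refine (hΦ y _ (by positivity)).trans ?_
        rw [mul_pow, ENNReal.ofReal_mul (by positivity), ENNReal.ofReal_pow (by positivity),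
          ENNReal.ofReal_ofNat]
        calc K * (6 ^ (n - 1) * ENNReal.ofReal (ρ y ^ (n - 1)))
            ≤ K * (6 ^ (n - 1) *
              (c * levelVariation (ν.restrict (Metric.ball (y : E) (ρ y))) v t)) := by
              gcongr
              exact hρV y (hUS y.2)
          _ = _ := by ring
    _ ≤ _ := by
        rw [ENNReal.tsum_mul_left]
        gcongr

/-- Boxing integrated over levels. As |v| need not be C¹, the argument runs for v and -v separately,
which gives the factor 2. -/
theorem exists_lintegral_outerMeasure_superlevel_le : ∃ C : ℝ≥0∞, C ≠ ⊤ ∧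
    ∀ (Φ : OuterMeasure E) (K : ℝ≥0∞), K ≠ ⊤ → (∀ (x : E) (r : ℝ), 0 < r →
      Φ (Metric.ball x r) ≤ K * ENNReal.ofReal (r ^ (Module.finrank ℝ E - 1))) →
    ∀ v : E → ℝ, ContDiff ℝ 1 v → Integrable v ν →
      ∫⁻ t in Ioi (0 : ℝ), Φ {x | t < |v x|} ≤ C * K * ∫⁻ x, ‖fderiv ℝ v x‖ₑ ∂ν := by
  set c : ℝ≥0∞ := 6 ^ (Module.finrank ℝ E - 1) *
      (2 ^ (2 * Module.finrank ℝ E + 3) / ν (Metric.ball 0 1)) with hc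
  have hct : c ≠ ⊤ := ENNReal.mul_ne_top (by simp) (ENNReal.div_lt_top (by simp)
    (Metric.measure_ball_pos ν _ one_pos).ne').ne
  set I := ∫⁻ s, ‖deriv Real.smoothTransition s‖ₑ with hI
  refine ⟨2 * (c * I), ENNReal.mul_ne_top (by simp)
    (ENNReal.mul_ne_top hct lintegral_enorm_deriv_smoothTransition_ne_top),
    fun Φ K hK hΦ v hv hvi => ?_⟩
  have hone : ∀ w : E → ℝ, ContDiff ℝ 1 w → Integrable w ν →
      ∫⁻ t in Ioi (0 : ℝ), Φ {x | t < w x} ≤ c * K * (I * ∫⁻ x, ‖fderiv ℝ w x‖ₑ ∂ν) := by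
    intro w hw hwi
    calc ∫⁻ t in Ioi (0 : ℝ), Φ {x | t < w x}
        ≤ ∫⁻ t in Ioi (0 : ℝ), c * K * levelVariation ν w t :=
          setLIntegral_mono' measurableSet_Ioi fun t ht =>
            outerMeasure_superlevel_le_levelVariation ν Φ hΦ hw (hwi.measure_gt_lt_top ht)
      _ ≤ ∫⁻ t, c * K * levelVariation ν w t := setLIntegral_le_lintegral _ _
      _ = c * K * ∫⁻ t, levelVariation ν w t :=
          lintegral_const_mul' _ _ (ENNReal.mul_ne_top hct hK)
      _ ≤ _ := by
          gcongr
          exact lintegral_levelVariation_le ν hw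
  have hneg := hone (fun x => -v x) hv.neg hvi.neg
  simp only [fderiv_fun_neg, enorm_neg] at hneg
  -- Φ is only an outer measure, so measurability in t comes from monotonicity.
  have hanti : Antitone fun t => Φ {x | t < v x} :=
    fun s t hst => measure_mono fun x (hx : t < v x) => hst.trans_lt hx
  calc ∫⁻ t in Ioi (0 : ℝ), Φ {x | t < |v x|}
      ≤ ∫⁻ t in Ioi (0 : ℝ), (Φ {x | t < v x} + Φ {x | t < -v x}) := by
        refine lintegral_mono fun t => (measure_mono ?_).trans (measure_union_le _ _)
        intro x hx
        exact lt_abs.1 (show t < |v x| from hx)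
    _ = (∫⁻ t in Ioi (0 : ℝ), Φ {x | t < v x}) + ∫⁻ t in Ioi (0 : ℝ), Φ {x | t < -v x} :=
        lintegral_add_left hanti.measurable _
    _ ≤ _ := add_le_add (hone v hv hvi) hneg
    _ = _ := by ring

end Boxing

/-! ### Mollification in L¹. -/

section Mollification

open scoped Convolution
open ContinuousLinearMap (lsmul)

variable {E : Type*} [NormedAddCommGroup E] [NormedSpace ℝ E]
  [MeasurableSpace E] [BorelSpace E] [FiniteDimensional ℝ E]
  (ν : Measure E) [ν.IsAddHaarMeasure]
  {F : Type*} [NormedAddCommGroup F]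

theorem tendsto_lintegral_enorm_translate_sub_of_hasCompactSupport {h : E → F}
    (hc : Continuous h) (hs : HasCompactSupport h) :
    Tendsto (fun y => ∫⁻ x, ‖h (x - y) - h x‖ₑ ∂ν) (𝓝 0) (𝓝 0) := by
  obtain ⟨M, hM⟩ := hc.bounded_above_of_compact_support hs
  set T := Metric.cthickening 1 (tsupport h)
  have hT : IsCompact T := hs.isCompact.cthickening
  have hlim := tendsto_lintegral_filter_of_dominated_convergence (μ := ν) (l := 𝓝 (0 : E))
    (F := fun y x => ‖h (x - y) - h x‖ₑ) (f := fun _ => 0)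
    (T.indicator fun _ => ENNReal.ofReal (M + M)) ?_ ?_ ?_ ?_
  · simpa using hlim
  · exact Eventually.of_forall fun y => by
      have : Continuous fun x => h (x - y) - h x := by fun_prop
      exact this.enorm.measurable
  · filter_upwards [Metric.closedBall_mem_nhds (0 : E) one_pos] with y hy
    refine Eventually.of_forall fun x => ?_
    by_cases hx : x ∈ T
    · rw [indicator_of_mem hx, ← ofReal_norm]
      exact ENNReal.ofReal_le_ofReal ((norm_sub_le _ _).trans (add_le_add (hM _) (hM _)))
    · have h1 : h x = 0 := image_eq_zero_of_notMem_tsupport fun hx' =>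
        hx (Metric.self_subset_cthickening _ hx')
      have h2 : h (x - y) = 0 := image_eq_zero_of_notMem_tsupport fun hx' =>
        hx (Metric.mem_cthickening_of_dist_le x (x - y) 1 _ hx' (by simpa using hy))
      simp [h1, h2]
  · rw [lintegral_indicator hT.measurableSet, setLIntegral_const]
    exact ENNReal.mul_ne_top ENNReal.ofReal_ne_top hT.measure_lt_top.ne
  · refine Eventually.of_forall fun x => ?_
    have : Continuous fun y => ‖h (x - y) - h x‖ₑ := by
      have : Continuous fun y => h (x - y) - h x := by fun_prop
      exact this.enorm
    simpa using this.tendsto 0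

variable [NormedSpace ℝ F]

theorem tendsto_lintegral_enorm_translate_sub {g : E → F} (hg : Integrable g ν) :
    Tendsto (fun y => ∫⁻ x, ‖g (x - y) - g x‖ₑ ∂ν) (𝓝 0) (𝓝 0) := by
  rw [ENNReal.tendsto_nhds_zero]
  intro ε hε
  have hε3 : ε / 3 ≠ 0 := by simpa using hε.ne'
  obtain ⟨h, hs, hgh, hc, hhi⟩ := hg.exists_hasCompactSupport_lintegral_sub_le hε3
  filter_upwards [ENNReal.tendsto_nhds_zero.1
    (tendsto_lintegral_enorm_translate_sub_of_hasCompactSupport ν hc hs) (ε / 3)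
    (pos_iff_ne_zero.2 hε3)] with y hy
  have hm1 : AEMeasurable (fun x => ‖g x - h x‖ₑ) ν := (hg.sub hhi).1.enorm
  have hm2 : AEMeasurable (fun x => ‖g (x - y) - h (x - y)‖ₑ) ν :=
    hm1.comp_quasiMeasurePreserving (measurePreserving_sub_right ν y).quasiMeasurePreserving
  calc ∫⁻ x, ‖g (x - y) - g x‖ₑ ∂ν
      ≤ ∫⁻ x, (‖g (x - y) - h (x - y)‖ₑ + (‖h (x - y) - h x‖ₑ + ‖g x - h x‖ₑ)) ∂ν := by
        refine lintegral_mono fun x => ?_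
        have : g (x - y) - g x =
          (g (x - y) - h (x - y)) + ((h (x - y) - h x) + -(g x - h x)) := by abel
        rw [this]
        refine (enorm_add_le _ _).trans (add_le_add le_rfl ((enorm_add_le _ _).trans ?_))
        rw [enorm_neg]
    _ = (∫⁻ x, ‖g x - h x‖ₑ ∂ν) + ((∫⁻ x, ‖h (x - y) - h x‖ₑ ∂ν) + ∫⁻ x, ‖g x - h x‖ₑ ∂ν) := by
        rw [lintegral_add_left' hm2, lintegral_add_right' _ hm1]
        congr 1
        exact lintegral_sub_right_eq_self (fun x => ‖g x - h x‖ₑ) y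
    _ ≤ ε / 3 + (ε / 3 + ε / 3) := by gcongr
    _ = ε := by rw [← add_assoc, ENNReal.add_thirds]

/-- The bump has integral 1, so the error is an average of translation errors over its support;
Tonelli transfers their L¹ bound. -/
theorem lintegral_enorm_normed_convolution_sub_le [CompleteSpace F] (φ : ContDiffBump (0 : E))
    {g : E → F} (hg : Integrable g ν) {δ : ℝ≥0∞}
    (hδ : ∀ y ∈ Metric.ball (0 : E) φ.rOut, ∫⁻ x, ‖g (x - y) - g x‖ₑ ∂ν ≤ δ) :
    ∫⁻ x, ‖(φ.normed ν ⋆[lsmul ℝ ℝ, ν] g) x - g x‖ₑ ∂ν ≤ δ := by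
  have hφi : Integrable (φ.normed ν) ν := φ.integrable_normed
  have hpt : ∀ x, ‖(φ.normed ν ⋆[lsmul ℝ ℝ, ν] g) x - g x‖ₑ ≤
      ∫⁻ t, ‖φ.normed ν t‖ₑ * ‖g (x - t) - g x‖ₑ ∂ν := by
    intro x
    have hex : Integrable (fun t => φ.normed ν t • g (x - t)) ν :=
      φ.hasCompactSupport_normed.convolutionExists_left (lsmul ℝ ℝ) φ.continuous_normed
        hg.locallyIntegrable x
    have h1 : (φ.normed ν ⋆[lsmul ℝ ℝ, ν] g) x - g x =
        ∫ t, φ.normed ν t • (g (x - t) - g x) ∂ν := by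
      simp only [smul_sub]
      rw [integral_sub hex (hφi.smul_const _), integral_smul_const, φ.integral_normed, one_smul]
      rfl
    rw [h1]
    refine (enorm_integral_le_lintegral_enorm _).trans (le_of_eq ?_)
    simp only [enorm_smul]
  have hm : AEMeasurable (fun p : E × E => ‖φ.normed ν p.2‖ₑ * ‖g (p.1 - p.2) - g p.1‖ₑ)
      (ν.prod ν) := by
    refine AEMeasurable.mul ?_ (AEStronglyMeasurable.enorm (AEStronglyMeasurable.sub ?_ ?_))
    · exact (φ.continuous_normed.comp continuous_snd).enorm.measurable.aemeasurable
    · exact hg.1.comp_quasiMeasurePreserving (quasiMeasurePreserving_sub_of_right_invariant ν ν)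
    · exact hg.1.comp_fst
  calc ∫⁻ x, ‖(φ.normed ν ⋆[lsmul ℝ ℝ, ν] g) x - g x‖ₑ ∂ν
      ≤ ∫⁻ x, ∫⁻ t, ‖φ.normed ν t‖ₑ * ‖g (x - t) - g x‖ₑ ∂ν ∂ν := lintegral_mono hpt
    _ = ∫⁻ t, ∫⁻ x, ‖φ.normed ν t‖ₑ * ‖g (x - t) - g x‖ₑ ∂ν ∂ν := lintegral_lintegral_swap hm
    _ ≤ ∫⁻ t, ‖φ.normed ν t‖ₑ * δ ∂ν := by
        refine lintegral_mono fun t => ?_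
        dsimp only
        rw [lintegral_const_mul' _ _ enorm_ne_top]
        by_cases ht : t ∈ Metric.ball (0 : E) φ.rOut
        · exact mul_le_mul_right (hδ t ht) _
        · have : φ.normed ν t = 0 := by
            rw [← Function.notMem_support, φ.support_normed_eq]
            exact ht
          simp [this]
    _ = δ := by
        rw [lintegral_mul_const _ φ.continuous_normed.enorm.measurable,
          ← ofReal_integral_norm_eq_lintegral_enorm hφi]
        simp only [Real.norm_of_nonneg (φ.nonneg_normed _), φ.integral_normed,
          ENNReal.ofReal_one, one_mul]

/-- A sequence of smooth bump functions at the origin with supports shrinking to it. -/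
noncomputable def shrinkingBump (E : Type*) [NormedAddCommGroup E] (k : ℕ) :
    ContDiffBump (0 : E) where
  rIn := 1 / ((k : ℝ) + 2)
  rOut := 1 / ((k : ℝ) + 1)
  rIn_pos := by positivity
  rIn_lt_rOut := by
    apply one_div_lt_one_div_of_lt <;> [positivity; linarith]

theorem tendsto_lintegral_enorm_shrinkingBump_convolution_sub [CompleteSpace F]
    {g : E → F} (hg : Integrable g ν) :
    Tendsto (fun k => ∫⁻ x, ‖((shrinkingBump E k).normed ν ⋆[lsmul ℝ ℝ, ν] g) x - g x‖ₑ ∂ν)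
      atTop (𝓝 0) := by
  rw [ENNReal.tendsto_nhds_zero]
  intro ε hε
  obtain ⟨ρ, hρ, hsub⟩ := Metric.eventually_nhds_iff_ball.1
    (ENNReal.tendsto_nhds_zero.1 (tendsto_lintegral_enorm_translate_sub ν hg) ε hε)
  filter_upwards [tendsto_one_div_add_atTop_nhds_zero_nat.eventually (gt_mem_nhds hρ)] with k hk
  exact lintegral_enorm_normed_convolution_sub_le ν _ hg fun y hy =>
    hsub y (Metric.ball_subset_ball (show (shrinkingBump E k).rOut ≤ ρ from hk.le) hy)

end Mollification

/-! ### Smooth approximation in W^{1,1}. -/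

section Sobolev

open scoped Convolution
open ContinuousLinearMap (lsmul)

variable {d : ℕ}

/-- The derivative falls on φ, and the weak gradient is tested against s ↦ φ(x - s); the sign from
the reflection cancels the one in the definition. -/
theorem HasWeakGradient.fderiv_convolution {u : EuclideanSpace ℝ (Fin d) → ℝ}
    {G : EuclideanSpace ℝ (Fin d) → EuclideanSpace ℝ (Fin d)} (h : HasWeakGradient u G)
    (hu : LocallyIntegrable u) (hG : LocallyIntegrable G) {φ : EuclideanSpace ℝ (Fin d) → ℝ}
    (hφ : ContDiff ℝ ∞ φ) (hφs : HasCompactSupport φ) (x : EuclideanSpace ℝ (Fin d)) :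
    fderiv ℝ (φ ⋆[lsmul ℝ ℝ] u) x = innerSL ℝ ((φ ⋆[lsmul ℝ ℝ] G) x) := by
  have hφ1 : ContDiff ℝ 1 φ := hφ.of_le (by simp)
  rw [(hφs.hasFDerivAt_convolution_left (lsmul ℝ ℝ) hφ1 hu x).fderiv]
  have hexG : Integrable (fun t => φ t • G (x - t)) :=
    hφs.convolutionExists_left (lsmul ℝ ℝ) hφ.continuous hG x
  have hexu := (hφs.fderiv (𝕜 := ℝ)).convolutionExists_left
    ((lsmul ℝ ℝ : ℝ →L[ℝ] ℝ →L[ℝ] ℝ).precompL (EuclideanSpace ℝ (Fin d)))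
    (hφ1.continuous_fderiv one_ne_zero) hu x
  have hbasis : ∀ i : Fin d, (fderiv ℝ φ ⋆[(lsmul ℝ ℝ : ℝ →L[ℝ] ℝ →L[ℝ] ℝ).precompL
      (EuclideanSpace ℝ (Fin d))] u) x (EuclideanSpace.single i 1) =
      innerSL ℝ ((φ ⋆[lsmul ℝ ℝ] G) x) (EuclideanSpace.single i 1) := by
    intro i
    have hψ : ContDiff ℝ ∞ fun s => φ (x - s) := hφ.comp (contDiff_const.sub contDiff_id)
    have hψs : HasCompactSupport fun s => φ (x - s) :=
      hφs.comp_homeomorph (Homeomorph.subLeft x)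
    have hD : ∀ s, fderiv ℝ (fun s => φ (x - s)) s (EuclideanSpace.single i 1) =
        -fderiv ℝ φ (x - s) (EuclideanSpace.single i 1) := by
      intro s
      have h1 : HasFDerivAt (fun s => x - s)
        (-ContinuousLinearMap.id ℝ (EuclideanSpace ℝ (Fin d))) s := (hasFDerivAt_id s).const_sub x
      have h2 := ((hφ1.differentiable one_ne_zero (x - s)).hasFDerivAt).comp s h1
      rw [show (fun s => φ (x - s)) = φ ∘ (fun s => x - s) from rfl, h2.fderiv]
      simp
    have hw := h _ hψ hψs i
    simp only [hD, mul_neg] at hw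
    rw [integral_neg, neg_inj] at hw
    rw [convolution_def, ContinuousLinearMap.integral_apply hexu,
      innerSL_apply_apply, EuclideanSpace.inner_single_right, convolution_def]
    have hproj : (∫ t, (lsmul ℝ ℝ) (φ t) (G (x - t))).ofLp i = ∫ t, φ t * G (x - t) i := by
      have := (EuclideanSpace.proj (𝕜 := ℝ) i : EuclideanSpace ℝ (Fin d) →L[ℝ] ℝ).integral_comp_comm
        hexG
      simpa using this.symm
    rw [hproj]
    simp only [ContinuousLinearMap.precompL_apply, ContinuousLinearMap.lsmul_apply, smul_eq_mul,
      one_mul, conj_trivial]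
    rw [← integral_sub_left_eq_self (fun t => φ t * G (x - t) i) _ x,
      ← integral_sub_left_eq_self
        (fun t => fderiv ℝ φ t (EuclideanSpace.single i 1) * u (x - t)) _ x]
    simp only [sub_sub_cancel]
    simpa only [mul_comm] using hw
  refine ContinuousLinearMap.coe_injective ?_
  refine (EuclideanSpace.basisFun (Fin d) ℝ).toBasis.ext fun i => ?_
  simpa using hbasis i

theorem IsW11.exists_contDiff_approx {u : EuclideanSpace ℝ (Fin d) → ℝ}
    {G : EuclideanSpace ℝ (Fin d) → EuclideanSpace ℝ (Fin d)} (h : IsW11 u G) :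
    ∃ v : ℕ → EuclideanSpace ℝ (Fin d) → ℝ, (∀ k, ContDiff ℝ 1 (v k)) ∧
      (∀ k, Integrable (v k)) ∧
      Tendsto (fun k => ∫⁻ x, ‖v k x - u x‖ₑ) atTop (𝓝 0) ∧
      Tendsto (fun k => ∫⁻ x, ‖fderiv ℝ (v k) x - innerSL ℝ (G x)‖ₑ) atTop (𝓝 0) := by
  set b := fun k => (shrinkingBump (EuclideanSpace ℝ (Fin d)) k).normed volume
  have hbs : ∀ k, HasCompactSupport (b k) := fun k => ContDiffBump.hasCompactSupport_normed _
  have hbc : ∀ k, ContDiff ℝ ∞ (b k) := fun k => ContDiffBump.contDiff_normed _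
  refine ⟨fun k => b k ⋆[lsmul ℝ ℝ] u, fun k => ?_, fun k => ?_,
    tendsto_lintegral_enorm_shrinkingBump_convolution_sub volume h.integrable, ?_⟩
  · exact (hbs k).contDiff_convolution_left (n := 1) _ ((hbc k).of_le (by simp))
      h.integrable.locallyIntegrable
  · exact (ContDiffBump.integrable_normed _).integrable_convolution _ h.integrable
  · refine (tendsto_lintegral_enorm_shrinkingBump_convolution_sub volume
      h.integrable_grad).congr fun k => lintegral_congr fun x => ?_
    rw [h.weakGradient.fderiv_convolution h.integrable.locallyIntegrable
      h.integrable_grad.locallyIntegrable (hbc k) (hbs k), ← map_sub]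
    simp only [← ofReal_norm, innerSL_apply_norm]
    rfl

end Sobolev

/-! ### From C¹ functions to their limits. -/

section Approximation

variable {E : Type*} [NormedAddCommGroup E] [NormedSpace ℝ E]
  [MeasurableSpace E] (ν : Measure E)

/-- Along an a.e. convergent subsequence, |w x| > t forces |v_k x| > t for all large k, off a null
set. Continuity along increasing unions therefore bounds Φ of the limit's superlevel set by a lower
limit, and Fatou in t concludes. -/
theorem lintegral_outerMeasure_superlevel_le_of_approx (Φ : OuterMeasure E)
    (hnull : ∀ A, ν A = 0 → Φ A = 0)
    (hmono : ∀ A : ℕ → Set E, Monotone A → Φ (⋃ n, A n) ≤ ⨆ n, Φ (A n)) {c : ℝ≥0∞} (hc : c ≠ ⊤)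
    (hΦ : ∀ v : E → ℝ, ContDiff ℝ 1 v → Integrable v ν →
      ∫⁻ t in Ioi (0 : ℝ), Φ {x | t < |v x|} ≤ c * ∫⁻ x, ‖fderiv ℝ v x‖ₑ ∂ν)
    {w : E → ℝ} (hw : AEStronglyMeasurable w ν) {v : ℕ → E → ℝ} (hv : ∀ k, ContDiff ℝ 1 (v k))
    (hvi : ∀ k, Integrable (v k) ν)
    (hvw : Tendsto (fun k => ∫⁻ x, ‖v k x - w x‖ₑ ∂ν) atTop (𝓝 0))
    {D : E → E →L[ℝ] ℝ} (hD : AEStronglyMeasurable D ν)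
    (hvD : Tendsto (fun k => ∫⁻ x, ‖fderiv ℝ (v k) x - D x‖ₑ ∂ν) atTop (𝓝 0)) :
    ∫⁻ t in Ioi (0 : ℝ), Φ {x | t < |w x|} ≤ c * ∫⁻ x, ‖D x‖ₑ ∂ν := by
  have hmeas : TendstoInMeasure ν v atTop w := by
    refine tendstoInMeasure_of_tendsto_eLpNorm one_ne_zero (fun k => (hvi k).1) hw ?_
    simpa only [eLpNorm_one_eq_lintegral_enorm, Pi.sub_apply] using hvw
  obtain ⟨ns, hns, hae⟩ := hmeas.exists_seq_tendsto_ae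
  have hlevel : ∀ t, Φ {x | t < |w x|} ≤ liminf (fun k => Φ {x | t < |v (ns k) x|}) atTop := by
    intro t
    set A : ℕ → Set E := fun n => ⋂ k ≥ n, {x | t < |v (ns k) x|} with hA
    have hAm : Monotone A := fun m n hmn x hx => by
      simp only [hA, mem_iInter] at hx ⊢
      exact fun k hk => hx k (hmn.trans hk)
    have hsub : {x | t < |w x|} ⊆
        {x | ¬Tendsto (fun k => v (ns k) x) atTop (𝓝 (w x))} ∪ ⋃ n, A n := by
      intro x hx
      by_cases hlim : Tendsto (fun k => v (ns k) x) atTop (𝓝 (w x))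
      · obtain ⟨N, hN⟩ := eventually_atTop.1 (hlim.abs.eventually (lt_mem_nhds hx))
        refine Or.inr (mem_iUnion.2 ⟨N, ?_⟩)
        simp only [hA, mem_iInter]
        exact fun k hk => hN k hk
      · exact Or.inl hlim
    calc Φ {x | t < |w x|}
        ≤ Φ {x | ¬Tendsto (fun k => v (ns k) x) atTop (𝓝 (w x))} + Φ (⋃ n, A n) :=
          (measure_mono hsub).trans (measure_union_le _ _)
      _ = Φ (⋃ n, A n) := by rw [hnull _ (ae_iff.1 hae), zero_add]
      _ ≤ ⨆ n, Φ (A n) := hmono A hAm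
      _ ≤ liminf (fun k => Φ {x | t < |v (ns k) x|}) atTop := by
          rw [liminf_eq_iSup_iInf_of_nat]
          exact iSup_mono fun n => le_iInf₂ fun k hk => measure_mono (iInter₂_subset k hk)
  have hbound : ∀ k, ∫⁻ x, ‖fderiv ℝ (v k) x‖ₑ ∂ν ≤
      (∫⁻ x, ‖fderiv ℝ (v k) x - D x‖ₑ ∂ν) + ∫⁻ x, ‖D x‖ₑ ∂ν := by
    intro k
    rw [← lintegral_add_right' _ hD.enorm]
    refine lintegral_mono fun x => ?_
    simpa using enorm_add_le (fderiv ℝ (v k) x - D x) (D x)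
  have hlim : Tendsto (fun k => c * ((∫⁻ x, ‖fderiv ℝ (v (ns k)) x - D x‖ₑ ∂ν) +
      ∫⁻ x, ‖D x‖ₑ ∂ν)) atTop (𝓝 (c * ∫⁻ x, ‖D x‖ₑ ∂ν)) := by
    have h1 := ENNReal.Tendsto.const_mul (a := c)
      ((hvD.comp hns.tendsto_atTop).add_const (∫⁻ x, ‖D x‖ₑ ∂ν)) (Or.inr hc)
    rwa [zero_add] at h1
  have hanti : ∀ k, Measurable fun t => Φ {x | t < |v (ns k) x|} := fun k =>
    Antitone.measurable fun s t hst => measure_mono fun x (hx : t < |v (ns k) x|) => hst.trans_lt hx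
  calc ∫⁻ t in Ioi (0 : ℝ), Φ {x | t < |w x|}
      ≤ ∫⁻ t in Ioi (0 : ℝ), liminf (fun k => Φ {x | t < |v (ns k) x|}) atTop :=
        lintegral_mono hlevel
    _ ≤ liminf (fun k => ∫⁻ t in Ioi (0 : ℝ), Φ {x | t < |v (ns k) x|}) atTop :=
        lintegral_liminf_le hanti
    _ ≤ liminf (fun k => c * ((∫⁻ x, ‖fderiv ℝ (v (ns k)) x - D x‖ₑ ∂ν) +
          ∫⁻ x, ‖D x‖ₑ ∂ν)) atTop :=
        liminf_le_liminf (Eventually.of_forall fun k =>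
          (hΦ _ (hv _) (hvi _)).trans (mul_le_mul_right (hbound _) _))
    _ = c * ∫⁻ x, ‖D x‖ₑ ∂ν := hlim.liminf_eq

end Approximation

/-! ### The maximal function and its outer measure. -/

section Maximal

variable {E : Type*} [NormedAddCommGroup E] [MeasurableSpace E]

/-- The maximal function of the measure `κ` with respect to `ν`, over balls of dyadic radii. -/
noncomputable def dyadicMaximal (ν κ : Measure E) (x : E) : ℝ≥0∞ :=
  ⨆ k : ℤ, κ (Metric.ball x (2 ^ k)) / ν (Metric.ball x (2 ^ k))

theorem dyadicMaximal_mono (ν : Measure E) {κ₁ κ₂ : Measure E} (h : κ₁ ≤ κ₂) (x : E) :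
    dyadicMaximal ν κ₁ x ≤ dyadicMaximal ν κ₂ x :=
  iSup_mono fun _ => ENNReal.div_le_div_right (h _) _

variable [BorelSpace E]

theorem dyadicMaximal_restrict_iUnion_le (ν : Measure E) (A : ℕ → Set E) (x : E) :
    dyadicMaximal ν (ν.restrict (⋃ i, A i)) x ≤ ∑' i, dyadicMaximal ν (ν.restrict (A i)) x := by
  refine iSup_le fun k => ?_
  calc ν.restrict (⋃ i, A i) (Metric.ball x (2 ^ k)) / ν (Metric.ball x (2 ^ k))
      ≤ (∑' i, ν.restrict (A i) (Metric.ball x (2 ^ k))) / ν (Metric.ball x (2 ^ k)) := by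
        refine ENNReal.div_le_div_right ?_ _
        simp only [Measure.restrict_apply Metric.isOpen_ball.measurableSet, inter_iUnion]
        exact measure_iUnion_le _
    _ = ∑' i, ν.restrict (A i) (Metric.ball x (2 ^ k)) / ν (Metric.ball x (2 ^ k)) := by
        simp only [div_eq_mul_inv, ENNReal.tsum_mul_right]
    _ ≤ _ := ENNReal.tsum_le_tsum fun i =>
        le_iSup (fun k : ℤ => ν.restrict (A i) (Metric.ball x (2 ^ k)) /
          ν (Metric.ball x (2 ^ k))) k

theorem dyadicMaximal_restrict_iUnion_of_monotone (ν : Measure E) {A : ℕ → Set E}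
    (hA : Monotone A) (x : E) :
    dyadicMaximal ν (ν.restrict (⋃ i, A i)) x = ⨆ i, dyadicMaximal ν (ν.restrict (A i)) x := by
  simp only [dyadicMaximal]
  rw [iSup_comm]
  refine iSup_congr fun k => ?_
  simp only [Measure.restrict_apply Metric.isOpen_ball.measurableSet, inter_iUnion]
  rw [Monotone.measure_iUnion fun i j hij => inter_subset_inter_right _ (hA hij), ENNReal.iSup_div]

variable [SecondCountableTopology E]

theorem measurable_measure_ball (κ : Measure E) [SFinite κ] (r : ℝ) :
    Measurable fun x => κ (Metric.ball x r) :=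
  measurable_measure_prodMk_left (s := {p : E × E | dist p.2 p.1 < r})
    (measurableSet_lt (measurable_snd.dist measurable_fst) measurable_const)

theorem measurable_dyadicMaximal (ν κ : Measure E) [SFinite ν] [SFinite κ] :
    Measurable (dyadicMaximal ν κ) :=
  Measurable.iSup fun _ => (measurable_measure_ball κ _).div (measurable_measure_ball ν _)

/-- The outer measure `A ↦ ∫ M 1_A dμ`, where `M` is the dyadic maximal operator. -/
noncomputable def maximalOuterMeasure (ν μ : Measure E) [SFinite ν] : OuterMeasure E where
  measureOf A := ∫⁻ x, dyadicMaximal ν (ν.restrict A) x ∂μ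
  empty := by simp [dyadicMaximal]
  mono h := lintegral_mono fun x => dyadicMaximal_mono ν (Measure.restrict_mono_set ν h) x
  iUnion_nat A _ := by
    rw [← lintegral_tsum fun i => (measurable_dyadicMaximal ν (ν.restrict (A i))).aemeasurable]
    exact lintegral_mono fun x => dyadicMaximal_restrict_iUnion_le ν A x

theorem maximalOuterMeasure_apply (ν μ : Measure E) [SFinite ν] (A : Set E) :
    maximalOuterMeasure ν μ A = ∫⁻ x, dyadicMaximal ν (ν.restrict A) x ∂μ := rfl

theorem maximalOuterMeasure_null (ν μ : Measure E) [SFinite ν] {A : Set E} (hA : ν A = 0) :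
    maximalOuterMeasure ν μ A = 0 := by
  simp [maximalOuterMeasure_apply, dyadicMaximal, Measure.restrict_eq_zero.2 hA]

theorem maximalOuterMeasure_iUnion_le (ν μ : Measure E) [SFinite ν] {A : ℕ → Set E}
    (hA : Monotone A) :
    maximalOuterMeasure ν μ (⋃ n, A n) ≤ ⨆ n, maximalOuterMeasure ν μ (A n) := by
  simp only [maximalOuterMeasure_apply, dyadicMaximal_restrict_iUnion_of_monotone ν hA]
  rw [lintegral_iSup (fun n => measurable_dyadicMaximal ν (ν.restrict (A n)))]
  exact fun i j hij x => dyadicMaximal_mono ν (Measure.restrict_mono_set ν (hA hij)) x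

/-- Layer cake on each ball, then a supremum of integrals is at most the integral of the suprema:
M|w| ≤ ∫ M1_{|w|>t} dt pointwise. Tonelli finishes. -/
theorem lintegral_dyadicMaximal_withDensity_le (ν μ : Measure E) [ν.IsOpenPosMeasure] [SFinite ν]
    [SFinite μ] {w : E → ℝ} (hw : Measurable w) :
    ∫⁻ x, dyadicMaximal ν (ν.withDensity fun y => ‖w y‖ₑ) x ∂μ ≤
      ∫⁻ t in Ioi (0 : ℝ), maximalOuterMeasure ν μ {x | t < |w x|} := by
  have hpt : ∀ x, dyadicMaximal ν (ν.withDensity fun y => ‖w y‖ₑ) x ≤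
      ∫⁻ t in Ioi (0 : ℝ), dyadicMaximal ν (ν.restrict {y | t < |w y|}) x := by
    intro x
    refine iSup_le fun k => ?_
    set B := Metric.ball x ((2 : ℝ) ^ k) with hB
    have hBm : MeasurableSet B := Metric.isOpen_ball.measurableSet
    have hB0 : ν B ≠ 0 := (Metric.measure_ball_pos ν x (by positivity)).ne'
    have h1 : ∫⁻ y in B, ‖w y‖ₑ ∂ν = ∫⁻ t in Ioi (0 : ℝ), ν.restrict {y | t < |w y|} B := by
      have h2 := lintegral_eq_lintegral_meas_lt (ν.restrict B) (f := fun y => |w y|)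
        (Eventually.of_forall fun y => abs_nonneg (w y)) hw.abs.aemeasurable
      simp only [← Real.norm_eq_abs, ofReal_norm] at h2 ⊢
      rw [h2]
      refine lintegral_congr fun t => ?_
      rw [Measure.restrict_apply (measurableSet_lt measurable_const hw.norm),
        Measure.restrict_apply hBm, inter_comm]
    rw [withDensity_apply _ hBm, h1, div_eq_mul_inv,
      ← lintegral_mul_const' _ _ (ENNReal.inv_ne_top.2 hB0)]
    exact lintegral_mono fun t => le_iSup (fun k : ℤ => ν.restrict {y | t < |w y|}
      (Metric.ball x (2 ^ k)) / ν (Metric.ball x (2 ^ k))) k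
  have hjoint : Measurable fun p : E × ℝ => dyadicMaximal ν (ν.restrict {y | p.2 < |w y|}) p.1 := by
    refine Measurable.iSup fun k => Measurable.div ?_
      ((measurable_measure_ball ν _).comp measurable_fst)
    simp only [Measure.restrict_apply Metric.isOpen_ball.measurableSet]
    refine measurable_measure_prodMk_left (ν := ν)
      (s := {q : (E × ℝ) × E | dist q.2 q.1.1 < 2 ^ k ∧ q.1.2 < |w q.2|}) ?_
    refine (measurableSet_lt (measurable_snd.dist measurable_fst.fst) measurable_const).inter
      (measurableSet_lt measurable_fst.snd (hw.comp measurable_snd).abs)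
  calc ∫⁻ x, dyadicMaximal ν (ν.withDensity fun y => ‖w y‖ₑ) x ∂μ
      ≤ ∫⁻ x, (∫⁻ t in Ioi (0 : ℝ), dyadicMaximal ν (ν.restrict {y | t < |w y|}) x) ∂μ :=
        lintegral_mono hpt
    _ = _ := lintegral_lintegral_swap hjoint.aemeasurable

end Maximal

/-! ### Maximal estimates for Haar measure. -/

section MaximalHaar

variable {E : Type*} [NormedAddCommGroup E] [NormedSpace ℝ E]
  [MeasurableSpace E] [BorelSpace E] [FiniteDimensional ℝ E] [Nontrivial E]
  (ν : Measure E) [ν.IsAddHaarMeasure]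

theorem addHaar_ball_two_pow_mul (x y : E) {r : ℝ} (hr : 0 ≤ r) (m : ℕ) :
    ν (Metric.ball x (2 ^ m * r)) = (2 ^ Module.finrank ℝ E) ^ m * ν (Metric.ball y r) := by
  rw [Measure.addHaar_ball ν x (by positivity), Measure.addHaar_ball ν y hr, mul_pow,
    ENNReal.ofReal_mul (by positivity), ← pow_mul, ENNReal.ofReal_pow (by positivity), mul_assoc,
    ENNReal.ofReal_ofNat, ← pow_mul, mul_comm m]

/-- At distance about 2^K r from x₀, only balls of radius exceeding 2^(K-1) r meet B(x₀, r), so the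
averages are at most 2^(-n(K-1)). The leading 2^n absorbs the shift by one, and the single term k =
K of the series suffices. -/
theorem dyadicMaximal_restrict_ball_le (x₀ : E) {r : ℝ} (hr : 0 < r) (x : E) :
    dyadicMaximal ν (ν.restrict (Metric.ball x₀ r)) x ≤
      ∑' k : ℕ, 2 ^ Module.finrank ℝ E * ((2 ^ Module.finrank ℝ E)⁻¹) ^ k *
        (Metric.ball x₀ (2 ^ (k + 1) * r)).indicator 1 x := by
  set N : ℝ≥0∞ := 2 ^ Module.finrank ℝ E with hN
  have hN1 : 1 ≤ N := one_le_pow₀ one_le_two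
  have hN0 : N ≠ 0 := (zero_lt_one.trans_le hN1).ne'
  have hNt : N ≠ ⊤ := by simp [hN]
  have hex : ∃ k : ℕ, x ∈ Metric.ball x₀ (2 ^ (k + 1) * r) := by
    obtain ⟨k, hk⟩ := pow_unbounded_of_one_lt (dist x x₀ / r) (one_lt_two (α := ℝ))
    refine ⟨k, ?_⟩
    rw [div_lt_iff₀ hr] at hk
    rw [Metric.mem_ball, pow_succ]
    have : 0 < (2 : ℝ) ^ k * r := by positivity
    linarith
  classical
  have hK := Nat.find_spec hex
  have hmin : ∀ m, m < Nat.find hex → x ∉ Metric.ball x₀ (2 ^ (m + 1) * r) :=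
    fun m hm => Nat.find_min hex hm
  generalize Nat.find hex = K at hK hmin
  refine le_trans (iSup_le fun j => ?_) (ENNReal.le_tsum K)
  rw [indicator_of_mem hK, Pi.one_apply, mul_one,
    Measure.restrict_apply Metric.isOpen_ball.measurableSet]
  refine ENNReal.div_le_of_le_mul ?_
  rcases K with _ | m
  · rw [pow_zero, mul_one]
    exact (measure_mono inter_subset_left).trans (le_mul_of_one_le_left' hN1)
  · have hx := hmin m (Nat.lt_succ_self m)
    rw [Metric.mem_ball, not_lt, pow_succ] at hx
    rw [pow_succ, mul_comm (N⁻¹ ^ m), ← mul_assoc, ENNReal.mul_inv_cancel hN0 hNt, one_mul]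
    rcases le_or_gt ((2 : ℝ) ^ j) (2 ^ m * r) with hj | hj
    · have hempty : Metric.ball x (2 ^ j) ∩ Metric.ball x₀ r = ∅ := by
        refine (Metric.ball_disjoint_ball ?_).inter_eq
        have : r ≤ 2 ^ m * r := le_mul_of_one_le_left hr.le (one_le_pow₀ one_le_two)
        linarith
      simp [hempty]
    · calc ν (Metric.ball x (2 ^ j) ∩ Metric.ball x₀ r) ≤ ν (Metric.ball x₀ r) :=
            measure_mono inter_subset_right
        _ = N⁻¹ ^ m * ν (Metric.ball x (2 ^ m * r)) := by
            rw [addHaar_ball_two_pow_mul ν x x₀ hr.le, ← mul_assoc, ← mul_pow,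
              ENNReal.inv_mul_cancel hN0 hNt, one_pow, one_mul]
        _ ≤ N⁻¹ ^ m * ν (Metric.ball x (2 ^ j)) := by gcongr

/-- The decay 2^(-nk) beats the growth 2^(k(n-1)) of μ on the enlarged balls, leaving a geometric
series of ratio 1/2. -/
theorem maximalOuterMeasure_ball_le (μ : Measure E) {K : ℝ≥0∞}
    (hμ : ∀ (x : E) (r : ℝ), 0 < r →
      μ (Metric.ball x r) ≤ K * ENNReal.ofReal (r ^ (Module.finrank ℝ E - 1)))
    (x₀ : E) {r : ℝ} (hr : 0 < r) :
    maximalOuterMeasure ν μ (Metric.ball x₀ r) ≤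
      2 ^ (2 * Module.finrank ℝ E) * K * ENNReal.ofReal (r ^ (Module.finrank ℝ E - 1)) := by
  obtain ⟨m, hm⟩ : ∃ m, Module.finrank ℝ E = m + 1 :=
    Nat.exists_eq_succ_of_ne_zero (Module.finrank_pos (R := ℝ) (M := E)).ne'
  have h2 : (2 : ℝ≥0∞) * 2⁻¹ = 1 := ENNReal.mul_inv_cancel two_ne_zero ENNReal.ofNat_ne_top
  calc maximalOuterMeasure ν μ (Metric.ball x₀ r)
      ≤ ∫⁻ x, ∑' k : ℕ, 2 ^ Module.finrank ℝ E * ((2 ^ Module.finrank ℝ E)⁻¹) ^ k *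
        (Metric.ball x₀ (2 ^ (k + 1) * r)).indicator 1 x ∂μ :=
        lintegral_mono fun x => dyadicMaximal_restrict_ball_le ν x₀ hr x
    _ = ∑' k : ℕ, 2 ^ Module.finrank ℝ E * ((2 ^ Module.finrank ℝ E)⁻¹) ^ k *
          μ (Metric.ball x₀ (2 ^ (k + 1) * r)) := by
        rw [lintegral_tsum fun k => ((measurable_one.indicator
          Metric.isOpen_ball.measurableSet).const_mul _).aemeasurable]
        refine tsum_congr fun k => ?_
        rw [lintegral_const_mul _ (measurable_one.indicator Metric.isOpen_ball.measurableSet),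
          lintegral_indicator_one Metric.isOpen_ball.measurableSet]
    _ ≤ ∑' k : ℕ, 2 ^ (2 * m + 1) * K * ENNReal.ofReal (r ^ m) * 2⁻¹ ^ k := by
        refine ENNReal.tsum_le_tsum fun k => ?_
        refine (mul_le_mul_right (hμ x₀ _ (by positivity)) _).trans (le_of_eq ?_)
        rw [hm, Nat.add_sub_cancel, mul_pow, ENNReal.ofReal_mul (by positivity), ← pow_mul,
          ENNReal.ofReal_pow two_pos.le, ENNReal.ofReal_ofNat, ENNReal.inv_pow]
        calc (2 : ℝ≥0∞) ^ (m + 1) * (2⁻¹ ^ (m + 1)) ^ k *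
              (K * (2 ^ ((k + 1) * m) * ENNReal.ofReal (r ^ m)))
            = (2 * 2⁻¹) ^ (m * k) * (2 ^ (2 * m + 1) * K * ENNReal.ofReal (r ^ m) * 2⁻¹ ^ k) := by
              ring
          _ = _ := by rw [h2, one_pow, one_mul]
    _ = _ := by
        rw [ENNReal.tsum_mul_left, ENNReal.tsum_geometric, ENNReal.one_sub_inv_two, inv_inv, hm,
          Nat.add_sub_cancel]
        ring

theorem exists_lintegral_dyadicMaximal_le : ∃ C : ℝ≥0∞, C ≠ ⊤ ∧
    ∀ (μ : Measure E) [SFinite μ] (K : ℝ≥0∞), K ≠ ⊤ → (∀ (x : E) (r : ℝ), 0 < r →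
      μ (Metric.ball x r) ≤ K * ENNReal.ofReal (r ^ (Module.finrank ℝ E - 1))) →
    ∀ (w : E → ℝ), AEStronglyMeasurable w ν → ∀ v : ℕ → E → ℝ, (∀ k, ContDiff ℝ 1 (v k)) →
      (∀ k, Integrable (v k) ν) → Tendsto (fun k => ∫⁻ x, ‖v k x - w x‖ₑ ∂ν) atTop (𝓝 0) →
    ∀ D : E → E →L[ℝ] ℝ, AEStronglyMeasurable D ν →
      Tendsto (fun k => ∫⁻ x, ‖fderiv ℝ (v k) x - D x‖ₑ ∂ν) atTop (𝓝 0) →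
      ∫⁻ x, dyadicMaximal ν (ν.withDensity fun y => ‖w y‖ₑ) x ∂μ ≤
        C * K * ∫⁻ x, ‖D x‖ₑ ∂ν := by
  obtain ⟨C, hC, h⟩ := exists_lintegral_outerMeasure_superlevel_le ν
  refine ⟨C * 2 ^ (2 * Module.finrank ℝ E), ENNReal.mul_ne_top hC (by simp),
    fun μ _ K hK hμ w hw v hv hvi hvw D hD hvD => ?_⟩
  have hKt : 2 ^ (2 * Module.finrank ℝ E) * K ≠ ⊤ := ENNReal.mul_ne_top (by simp) hK
  -- The layer-cake bound wants a measurable function; the maximal function does not see the change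
  -- of representative.
  have heq : (fun y => ‖w y‖ₑ) =ᵐ[ν] fun y => ‖hw.mk w y‖ₑ := by
    filter_upwards [hw.ae_eq_mk] with y hy
    rw [hy]
  have hvw' : Tendsto (fun k => ∫⁻ x, ‖v k x - hw.mk w x‖ₑ ∂ν) atTop (𝓝 0) := by
    refine hvw.congr fun k => lintegral_congr_ae ?_
    filter_upwards [hw.ae_eq_mk] with y hy
    rw [hy]
  rw [withDensity_congr_ae heq, mul_assoc C]
  exact (lintegral_dyadicMaximal_withDensity_le ν μ hw.stronglyMeasurable_mk.measurable).trans
    (lintegral_outerMeasure_superlevel_le_of_approx ν _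
      (fun A hA => maximalOuterMeasure_null ν μ hA)
      (fun A hA => maximalOuterMeasure_iUnion_le ν μ hA) (ENNReal.mul_ne_top hC hKt)
      (h _ _ hKt fun x r hr => maximalOuterMeasure_ball_le ν μ hμ x hr)
      hw.stronglyMeasurable_mk.aestronglyMeasurable hv hvi hvw' hD hvD)

/-- Rounding r up to a power of 2 at most doubles it, hence the factor 2^n. -/
theorem enorm_setAverage_ball_le_dyadicMaximal (w : E → ℝ) (x : E) {r : ℝ} (hr : 0 < r) :
    ‖⨍ y in Metric.ball x r, w y ∂ν‖ₑ ≤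
      2 ^ Module.finrank ℝ E * dyadicMaximal ν (ν.withDensity fun y => ‖w y‖ₑ) x := by
  obtain ⟨k, hk1, hk2⟩ := exists_mem_Ioc_zpow hr (one_lt_two (α := ℝ))
  have hsub : Metric.ball x r ⊆ Metric.ball x (2 ^ (k + 1)) := Metric.ball_subset_ball hk2
  have hdouble : ν (Metric.ball x (2 ^ (k + 1))) ≤
      2 ^ Module.finrank ℝ E * ν (Metric.ball x r) := by
    have h1 := addHaar_ball_two_pow_mul ν x x hr.le 1
    rw [pow_one, pow_one] at h1
    rw [← h1]
    refine measure_mono (Metric.ball_subset_ball ?_)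
    rw [zpow_add_one₀ two_ne_zero]
    linarith
  calc ‖⨍ y in Metric.ball x r, w y ∂ν‖ₑ
      ≤ (ν (Metric.ball x r))⁻¹ * ∫⁻ y in Metric.ball x r, ‖w y‖ₑ ∂ν := by
        refine (enorm_integral_le_lintegral_enorm _).trans ?_
        rw [lintegral_smul_measure, Measure.restrict_apply_univ, smul_eq_mul]
    _ ≤ (2 ^ Module.finrank ℝ E * (ν (Metric.ball x (2 ^ (k + 1))))⁻¹) *
          ∫⁻ y in Metric.ball x (2 ^ (k + 1)), ‖w y‖ₑ ∂ν := by
        refine mul_le_mul' ?_ (lintegral_mono_set hsub)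
        rw [ENNReal.inv_le_iff_inv_le, ENNReal.mul_inv (by simp) (by simp), inv_inv,
          mul_comm, ← div_eq_mul_inv]
        exact ENNReal.div_le_of_le_mul' hdouble
    _ = 2 ^ Module.finrank ℝ E * ((ν.withDensity fun y => ‖w y‖ₑ) (Metric.ball x (2 ^ (k + 1))) /
          ν (Metric.ball x (2 ^ (k + 1)))) := by
        rw [withDensity_apply _ Metric.isOpen_ball.measurableSet, div_eq_mul_inv]
        ring
    _ ≤ _ := mul_le_mul_right (le_iSup (fun k : ℤ => (ν.withDensity fun y => ‖w y‖ₑ)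
          (Metric.ball x (2 ^ k)) / ν (Metric.ball x (2 ^ k))) (k + 1)) _

end MaximalHaar

/-! ### Convergence of ball averages. -/

section Averages

variable {E : Type*} [NormedAddCommGroup E] [NormedSpace ℝ E]
  [MeasurableSpace E] [BorelSpace E] [FiniteDimensional ℝ E]
  (ν : Measure E) [ν.IsAddHaarMeasure]

theorem tendsto_setAverage_ball_of_continuous {v : E → ℝ} (hv : Continuous v) (x : E) :
    Tendsto (fun r : ℝ => ⨍ y in Metric.ball x r, v y ∂ν) (𝓝[>] 0) (𝓝 (v x)) := by
  rw [Metric.nhds_basis_closedBall.tendsto_right_iff]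
  intro ε hε
  obtain ⟨ρ, hρ, hsub⟩ := Metric.eventually_nhds_iff_ball.1
    (hv.continuousAt.eventually (Metric.closedBall_mem_nhds (v x) hε))
  filter_upwards [Ioo_mem_nhdsGT hρ] with r hr
  refine (convex_closedBall (v x) ε).set_average_mem Metric.isClosed_closedBall
    (Metric.measure_ball_pos ν x hr.1).ne' measure_ball_lt_top.ne ?_ ?_
  · filter_upwards [ae_restrict_mem Metric.isOpen_ball.measurableSet] with y hy
    exact hsub y (Metric.ball_subset_ball hr.2.le hy)
  · exact (hv.locallyIntegrable.integrableOn_isCompact (isCompact_closedBall x r)).mono_set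
      Metric.ball_subset_closedBall

theorem stronglyMeasurable_setAverage_ball {w : E → ℝ} (hw : AEStronglyMeasurable w ν) (r : ℝ) :
    StronglyMeasurable fun x => ⨍ y in Metric.ball x r, w y ∂ν := by
  have h1 : ∀ x, ⨍ y in Metric.ball x r, w y ∂ν =
      (ν (Metric.ball x r)).toReal⁻¹ *
        ∫ y, (Metric.ball x r).indicator (hw.mk w) y ∂ν := by
    intro x
    rw [setAverage_eq, smul_eq_mul, integral_indicator Metric.isOpen_ball.measurableSet,
      setIntegral_congr_ae Metric.isOpen_ball.measurableSet
        (hw.ae_eq_mk.mono fun y hy _ => hy)]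
    rfl
  simp only [h1]
  refine StronglyMeasurable.mul (measurable_measure_ball ν r).ennreal_toReal.inv.stronglyMeasurable
    (StronglyMeasurable.integral_prod_right' (f := fun p : E × E =>
      {q : E × E | dist q.2 q.1 < r}.indicator (fun q => hw.mk w q.2) p) ?_)
  exact (hw.stronglyMeasurable_mk.comp_measurable measurable_snd).indicator
    (measurableSet_lt (measurable_snd.dist measurable_fst) measurable_const)

/-- At every radius the averages of w and v_k differ by at most 2^n M(w - v_k)(x), which is small
for some k, while those of v_k converge. So the averages of w are Cauchy as r → 0. -/
theorem exists_tendsto_setAverage_of_approx [Nontrivial E] {w : E → ℝ}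
    (hw : LocallyIntegrable w ν) {v : ℕ → E → ℝ} (hv : ∀ k, Continuous (v k)) {x : E}
    (hx : liminf (fun k => dyadicMaximal ν (ν.withDensity fun y => ‖w y - v k y‖ₑ) x) atTop = 0) :
    ∃ l, Tendsto (fun r : ℝ => ⨍ y in Metric.ball x r, w y ∂ν) (𝓝[>] 0) (𝓝 l) := by
  refine cauchy_iff_exists_le_nhds.1 (Metric.cauchy_iff.2 ⟨inferInstance, fun ε hε => ?_⟩)
  have hN0 : (2 : ℝ≥0∞) ^ Module.finrank ℝ E ≠ 0 := by simp
  have hNt : (2 : ℝ≥0∞) ^ Module.finrank ℝ E ≠ ⊤ := by simp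
  have hpos : (0 : ℝ≥0∞) < ENNReal.ofReal (ε / 4) / 2 ^ Module.finrank ℝ E :=
    ENNReal.div_pos (by simpa using hε) hNt
  obtain ⟨k, hk⟩ := (frequently_lt_of_liminf_lt (by isBoundedDefault) (hx ▸ hpos)).exists
  rw [ENNReal.lt_div_iff_mul_lt (Or.inl hN0) (Or.inl hNt), mul_comm] at hk
  have hev : ∀ᶠ r : ℝ in 𝓝[>] 0, dist (⨍ y in Metric.ball x r, w y ∂ν) (v k x) < ε / 2 := by
    filter_upwards [(Metric.tendsto_nhds.1 (tendsto_setAverage_ball_of_continuous ν (hv k) x))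
      (ε / 4) (by positivity), self_mem_nhdsWithin] with r hr hr0
    have hint : ∀ {f : E → ℝ}, LocallyIntegrable f ν → IntegrableOn f (Metric.ball x r) ν :=
      fun hf => (hf.integrableOn_isCompact (isCompact_closedBall x r)).mono_set
        Metric.ball_subset_closedBall
    have hsub : (⨍ y in Metric.ball x r, w y ∂ν) - ⨍ y in Metric.ball x r, v k y ∂ν =
        ⨍ y in Metric.ball x r, (w y - v k y) ∂ν := by
      simp only [setAverage_eq]
      rw [integral_sub (hint hw) (hint (hv k).locallyIntegrable), smul_sub]
    have h1 := (enorm_setAverage_ball_le_dyadicMaximal ν (fun y => w y - v k y) x hr0).trans_lt hk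
    rw [← hsub, ← ofReal_norm, ENNReal.ofReal_lt_ofReal_iff (by positivity), ← dist_eq_norm] at h1
    calc dist (⨍ y in Metric.ball x r, w y ∂ν) (v k x)
        ≤ _ := dist_triangle _ (⨍ y in Metric.ball x r, v k y ∂ν) _
      _ < ε / 4 + ε / 4 := add_lt_add h1 hr
      _ = ε / 2 := by ring
  refine ⟨Metric.ball (v k x) (ε / 2), mem_map.2 hev, fun a ha b hb => ?_⟩
  calc dist a b ≤ dist a (v k x) + dist b (v k x) := dist_triangle_right _ _ _
    _ < ε / 2 + ε / 2 := add_lt_add ha hb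
    _ = ε := by ring

end Averages

/-! ### The trace inequality. -/

section Trace

variable {d : ℕ}

theorem IsLimitOfAverages.preciseRep_eq {u : EuclideanSpace ℝ (Fin d) → ℝ}
    {x : EuclideanSpace ℝ (Fin d)} {l : ℝ} (h : IsLimitOfAverages u x l) :
    preciseRep u x = l := by
  have hex : ∃ l, IsLimitOfAverages u x l := ⟨l, h⟩
  rw [preciseRep, dif_pos hex]
  exact tendsto_nhds_unique hex.choose_spec h

theorem enorm_preciseRep_le [Nontrivial (EuclideanSpace ℝ (Fin d))]
    (u : EuclideanSpace ℝ (Fin d) → ℝ) (x : EuclideanSpace ℝ (Fin d)) :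
    ‖preciseRep u x‖ₑ ≤ 2 ^ Module.finrank ℝ (EuclideanSpace ℝ (Fin d)) *
      dyadicMaximal volume (volume.withDensity fun y => ‖u y‖ₑ) x := by
  by_cases hex : ∃ l, IsLimitOfAverages u x l
  · obtain ⟨l, hl⟩ := hex
    rw [hl.preciseRep_eq]
    refine le_of_tendsto hl.enorm ?_
    filter_upwards [self_mem_nhdsWithin] with r hr
    exact enorm_setAverage_ball_le_dyadicMaximal volume u x hr
  · simp [preciseRep, hex]

theorem aestronglyMeasurable_preciseRep {u : EuclideanSpace ℝ (Fin d) → ℝ}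
    (hu : AEStronglyMeasurable u) {μ : Measure (EuclideanSpace ℝ (Fin d))}
    (hμ : ∀ᵐ x ∂μ, ∃ l : ℝ, IsLimitOfAverages u x l) :
    AEStronglyMeasurable (preciseRep u) μ := by
  refine aestronglyMeasurable_of_tendsto_ae atTop
    (f := fun (n : ℕ) x => ⨍ y in Metric.ball x (1 / ((n : ℝ) + 1)), u y)
    (fun n => (stronglyMeasurable_setAverage_ball volume hu _).aestronglyMeasurable) ?_
  filter_upwards [hμ] with x ⟨l, hl⟩
  rw [hl.preciseRep_eq]
  refine hl.comp (tendsto_nhdsWithin_iff.2 ⟨tendsto_one_div_add_atTop_nhds_zero_nat, ?_⟩)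
  exact Eventually.of_forall fun n => mem_Ioi.2 (by positivity)

theorem IsW11.lintegral_enorm_innerSL {u : EuclideanSpace ℝ (Fin d) → ℝ}
    {G : EuclideanSpace ℝ (Fin d) → EuclideanSpace ℝ (Fin d)} (h : IsW11 u G) :
    ∫⁻ x, ‖innerSL ℝ (G x)‖ₑ = ENNReal.ofReal (∫ x, ‖G x‖) := by
  rw [ofReal_integral_norm_eq_lintegral_enorm h.integrable_grad]
  simp only [← ofReal_norm, innerSL_apply_norm]

theorem exists_trace_bound [Nontrivial (EuclideanSpace ℝ (Fin d))] : ∃ C : ℝ≥0∞, C ≠ ⊤ ∧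
    ∀ (μ : Measure (EuclideanSpace ℝ (Fin d))) [SFinite μ] (K : ℝ≥0∞), K ≠ ⊤ →
      (∀ (x : EuclideanSpace ℝ (Fin d)) (r : ℝ), 0 < r →
        μ (Metric.ball x r) ≤ K * ENNReal.ofReal (r ^ (d - 1))) →
    ∀ (u : EuclideanSpace ℝ (Fin d) → ℝ)
      (G : EuclideanSpace ℝ (Fin d) → EuclideanSpace ℝ (Fin d)), IsW11 u G →
      (∀ᵐ x ∂μ, ∃ l : ℝ, IsLimitOfAverages u x l) ∧
      ∫⁻ x, ‖preciseRep u x‖ₑ ∂μ ≤ C * K * ENNReal.ofReal (∫ x, ‖G x‖) := by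
  obtain ⟨C, hC, h⟩ := exists_lintegral_dyadicMaximal_le
    (volume : Measure (EuclideanSpace ℝ (Fin d)))
  rw [finrank_euclideanSpace_fin] at h
  refine ⟨2 ^ d * C, ENNReal.mul_ne_top (by simp) hC, fun μ _ K hK hμ u G hu => ?_⟩
  obtain ⟨v, hv, hvi, hvu, hvG⟩ := hu.exists_contDiff_approx
  have hGm : AEStronglyMeasurable fun x => innerSL ℝ (G x) :=
    (innerSL ℝ).continuous.comp_aestronglyMeasurable hu.integrable_grad.1
  have hDv : ∀ k, Continuous (fderiv ℝ (v k)) := fun k => (hv k).continuous_fderiv one_ne_zero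
  refine ⟨?_, ?_⟩
  -- The maximal estimate is applied to u - v_k, approximated by v_j - v_k as j → ∞; by Fatou the
  -- lower limit of M(u - v_k) then vanishes μ-almost everywhere.
  · have hbound : ∀ k,
        ∫⁻ x, dyadicMaximal volume (volume.withDensity fun y => ‖u y - v k y‖ₑ) x ∂μ ≤
        C * K * ∫⁻ x, ‖fderiv ℝ (v k) x - innerSL ℝ (G x)‖ₑ := by
      intro k
      have hsub : ∀ j x, fderiv ℝ (fun x => v j x - v k x) x = fderiv ℝ (v j) x - fderiv ℝ (v k) x :=
        fun j x => fderiv_fun_sub ((hv j).differentiable one_ne_zero x)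
          ((hv k).differentiable one_ne_zero x)
      have := h μ K hK hμ (fun x => u x - v k x) (hu.integrable.sub (hvi k)).1
        (fun j x => v j x - v k x) (fun j => (hv j).sub (hv k)) (fun j => (hvi j).sub (hvi k))
        (by simpa only [sub_sub_sub_cancel_right] using hvu)
        (fun x => innerSL ℝ (G x) - fderiv ℝ (v k) x)
        (hGm.sub (hDv k).aestronglyMeasurable)
        (by simpa only [hsub, sub_sub_sub_cancel_right] using hvG)
      refine this.trans (le_of_eq ?_)
      simp only [enorm_sub_rev]
    have hlim : Tendsto (fun k => C * K * ∫⁻ x, ‖fderiv ℝ (v k) x - innerSL ℝ (G x)‖ₑ) atTop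
        (𝓝 0) := by
      simpa using ENNReal.Tendsto.const_mul (a := C * K) hvG (Or.inr (ENNReal.mul_ne_top hC hK))
    have hmeas : ∀ k, Measurable
        (dyadicMaximal volume (volume.withDensity fun y => ‖u y - v k y‖ₑ)) := fun k => by
      have : SFinite (volume.withDensity fun y => ‖u y - v k y‖ₑ) := inferInstance
      exact measurable_dyadicMaximal _ _
    have hzero : ∫⁻ x, liminf (fun k =>
        dyadicMaximal volume (volume.withDensity fun y => ‖u y - v k y‖ₑ) x) atTop ∂μ = 0 := by
      refine le_antisymm ((lintegral_liminf_le hmeas).trans ?_) zero_le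
      rw [← hlim.liminf_eq]
      exact liminf_le_liminf (Eventually.of_forall hbound)
    rw [lintegral_eq_zero_iff (Measurable.liminf hmeas)] at hzero
    filter_upwards [hzero] with x hx
    exact exists_tendsto_setAverage_of_approx volume hu.integrable.locallyIntegrable
      (fun k => (hv k).continuous) hx
  · have hmax := h μ K hK hμ u hu.integrable.1 v hv hvi hvu _ hGm hvG
    rw [hu.lintegral_enorm_innerSL] at hmax
    calc ∫⁻ x, ‖preciseRep u x‖ₑ ∂μ
        ≤ ∫⁻ x, 2 ^ d * dyadicMaximal volume (volume.withDensity fun y => ‖u y‖ₑ) x ∂μ := by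
          refine lintegral_mono fun x => (enorm_preciseRep_le u x).trans (le_of_eq ?_)
          rw [finrank_euclideanSpace_fin]
      _ = 2 ^ d * ∫⁻ x, dyadicMaximal volume (volume.withDensity fun y => ‖u y‖ₑ) x ∂μ :=
          lintegral_const_mul' _ _ (by simp)
      _ ≤ 2 ^ d * (C * K * ENNReal.ofReal (∫ x, ‖G x‖)) := mul_le_mul_right hmax _
      _ = _ := by ring

end Trace

/-! ### Alvino, Gagliardo–Nirenberg and Hardy. -/

section Consequences

theorem ENNReal.iSup_rpow {ι : Sort*} (f : ι → ℝ≥0∞) {s : ℝ} (hs : 0 < s) :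
    (⨆ i, f i) ^ s = ⨆ i, f i ^ s :=
  (ENNReal.orderIsoRpow s hs).map_iSup f

theorem ENNReal.tsum_rpow_le {ι : Type*} (f : ι → ℝ≥0∞) {s : ℝ} (hs : 0 < s) (hs1 : s ≤ 1) :
    (∑' i, f i) ^ s ≤ ∑' i, f i ^ s := by
  rw [ENNReal.tsum_eq_iSup_sum, ENNReal.iSup_rpow _ hs]
  refine iSup_le fun T => le_trans ?_ (ENNReal.sum_le_tsum T)
  classical
  induction T using Finset.induction_on with
  | empty => simp [hs]
  | insert a T ha ih =>
    rw [Finset.sum_insert ha, Finset.sum_insert ha]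
    exact (ENNReal.rpow_add_le_add_rpow _ _ hs.le hs1).trans (add_le_add le_rfl ih)

/-- The outer measure `A ↦ ν A ^ s`, for `0 < s ≤ 1`. -/
noncomputable def rpowOuterMeasure {α : Type*} [MeasurableSpace α] (ν : Measure α) {s : ℝ}
    (hs : 0 < s) (hs1 : s ≤ 1) : OuterMeasure α where
  measureOf A := ν A ^ s
  empty := by simp [hs]
  mono h := ENNReal.rpow_le_rpow (measure_mono h) hs.le
  iUnion_nat A _ := (ENNReal.rpow_le_rpow (measure_iUnion_le A) hs.le).trans
    (ENNReal.tsum_rpow_le _ hs hs1)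

theorem rpowOuterMeasure_apply {α : Type*} [MeasurableSpace α] (ν : Measure α) {s : ℝ}
    (hs : 0 < s) (hs1 : s ≤ 1) (A : Set α) : rpowOuterMeasure ν hs hs1 A = ν A ^ s := rfl

theorem ofReal_mul_rpow_measure_lt_le {α : Type*} [MeasurableSpace α] (ν : Measure α)
    (f : α → ℝ) {s : ℝ} (hs : 0 < s) (t : ℝ) :
    ENNReal.ofReal t * ν {x | t < f x} ^ s ≤
      ∫⁻ τ in Ioi (0 : ℝ), ν {x | τ < f x} ^ s := by
  calc ENNReal.ofReal t * ν {x | t < f x} ^ s = ∫⁻ _ in Ioc 0 t, ν {x | t < f x} ^ s := by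
        rw [setLIntegral_const, Real.volume_Ioc, sub_zero, mul_comm]
    _ ≤ ∫⁻ τ in Ioc 0 t, ν {x | τ < f x} ^ s := by
        refine setLIntegral_mono' measurableSet_Ioc fun τ hτ => ENNReal.rpow_le_rpow ?_ hs.le
        exact measure_mono fun x (hx : t < f x) => hτ.2.trans_lt hx
    _ ≤ _ := lintegral_mono_set Ioc_subset_Ioi_self

/-- The embedding of L^{p,1} in L^p. With m(t) the distribution function and A the integral of
m^(1/p), monotonicity gives t m(t)^(1/p) ≤ A, so t^(p-1) m ≤ m^(1/p) A^(p-1); integrate. -/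
theorem eLpNorm_le_lintegral_rpow_measure_lt {α : Type*} [MeasurableSpace α] (ν : Measure α)
    {f : α → ℝ} (hf : AEStronglyMeasurable f ν) {p : ℝ} (hp : 1 ≤ p) :
    eLpNorm f (ENNReal.ofReal p) ν ≤
      ENNReal.ofReal p ^ (1 / p) * ∫⁻ t in Ioi (0 : ℝ), ν {x | t < |f x|} ^ (1 / p) := by
  have hp0 : 0 < p := one_pos.trans_le hp
  set A := ∫⁻ t in Ioi (0 : ℝ), ν {x | t < |f x|} ^ (1 / p) with hA
  have hanti : Antitone fun t => ν {x | t < |f x|} ^ (1 / p) := fun a b hab =>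
    ENNReal.rpow_le_rpow (measure_mono fun x (hx : b < |f x|) => hab.trans_lt hx) (by positivity)
  have hpt : ∀ t ∈ Ioi (0 : ℝ), ν {x | t < |f x|} * ENNReal.ofReal (t ^ (p - 1)) ≤
      ν {x | t < |f x|} ^ (1 / p) * A ^ (p - 1) := by
    intro t ht
    set m := ν {x | t < |f x|}
    calc m * ENNReal.ofReal (t ^ (p - 1))
        = m ^ (1 / p) * (ENNReal.ofReal t * m ^ (1 / p)) ^ (p - 1) := by
          rw [ENNReal.mul_rpow_of_nonneg _ _ (by linarith), ← ENNReal.ofReal_rpow_of_pos ht,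
            ← ENNReal.rpow_mul, mul_left_comm,
            ← ENNReal.rpow_add_of_nonneg _ _ (by positivity)
              (mul_nonneg (by positivity) (by linarith)), mul_comm m]
          congr 1
          rw [show 1 / p + 1 / p * (p - 1) = 1 by field_simp; ring, ENNReal.rpow_one]
      _ ≤ m ^ (1 / p) * A ^ (p - 1) := mul_le_mul_right (ENNReal.rpow_le_rpow
          (ofReal_mul_rpow_measure_lt_le ν (fun x => |f x|) (by positivity) t) (by linarith)) _
  have hint : ∫⁻ x, ‖f x‖ₑ ^ p ∂ν ≤ ENNReal.ofReal p * A ^ p := by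
    have h1 := lintegral_rpow_eq_lintegral_meas_lt_mul ν (f := fun x => |f x|)
      (Eventually.of_forall fun x => abs_nonneg (f x)) hf.norm.aemeasurable hp0
    calc ∫⁻ x, ‖f x‖ₑ ^ p ∂ν = ∫⁻ x, ENNReal.ofReal (|f x| ^ p) ∂ν := by
          refine lintegral_congr fun x => ?_
          rw [← ENNReal.ofReal_rpow_of_nonneg (abs_nonneg _) hp0.le, ← Real.norm_eq_abs,
            ofReal_norm]
      _ ≤ ENNReal.ofReal p * ∫⁻ t in Ioi (0 : ℝ), ν {x | t < |f x|} ^ (1 / p) * A ^ (p - 1) := by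
          rw [h1]
          exact mul_le_mul_right (setLIntegral_mono' measurableSet_Ioi hpt) _
      _ = ENNReal.ofReal p * A ^ p := by
          rw [lintegral_mul_const _ hanti.measurable, ← hA]
          congr 1
          nth_rw 1 [← ENNReal.rpow_one A]
          rw [← ENNReal.rpow_add_of_nonneg _ _ zero_le_one (by linarith), add_sub_cancel]
  rw [eLpNorm_eq_lintegral_rpow_enorm_toReal (by simpa using hp0) ENNReal.ofReal_ne_top,
    ENNReal.toReal_ofReal hp0.le]
  calc (∫⁻ x, ‖f x‖ₑ ^ p ∂ν) ^ (1 / p) ≤ (ENNReal.ofReal p * A ^ p) ^ (1 / p) :=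
        ENNReal.rpow_le_rpow hint (by positivity)
    _ = _ := by
        rw [ENNReal.mul_rpow_of_nonneg _ _ (by positivity), ← ENNReal.rpow_mul,
          mul_one_div_cancel hp0.ne', ENNReal.rpow_one]

section HardyWeight

theorem ofReal_inv_norm_le_tsum {E : Type*} [NormedAddCommGroup E] {r : ℝ} (hr : 0 < r) {y : E}
    (hy : ‖y‖ ≤ r) :
    ENNReal.ofReal ‖y‖⁻¹ ≤ ∑' k : ℕ, ENNReal.ofReal (2 ^ (k + 1) / r) *
      (Metric.closedBall (0 : E) ((1 / 2) ^ k * r)).indicator 1 y := by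
  rcases eq_or_ne y 0 with rfl | hy0
  · simp
  have hn : 0 < ‖y‖ := norm_pos_iff.2 hy0
  obtain ⟨k, hk1, hk2⟩ := exists_nat_pow_near_of_lt_one (x := ‖y‖ / r) (y := 1 / 2)
    (by positivity) ((div_le_one hr).2 hy) (by norm_num) (by norm_num)
  rw [div_le_iff₀ hr] at hk2
  rw [lt_div_iff₀ hr] at hk1
  refine le_trans ?_ (ENNReal.le_tsum k)
  rw [indicator_of_mem (by simpa using hk2), Pi.one_apply, mul_one]
  refine ENNReal.ofReal_le_ofReal ?_
  rw [inv_le_comm₀ hn (by positivity), inv_div]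
  refine le_trans (le_of_eq ?_) hk1.le
  rw [one_div_pow]
  field_simp

variable {E : Type*} [NormedAddCommGroup E] [NormedSpace ℝ E]
  [MeasurableSpace E] [BorelSpace E] [FiniteDimensional ℝ E]
  (ν : Measure E) [ν.IsAddHaarMeasure]

/-- The dyadic terms scale like 2^(k(1-n)), at most 2^(-k) exactly because n ≥ 2. -/
theorem setLIntegral_inv_norm_closedBall_le (hn : 2 ≤ Module.finrank ℝ E) {r : ℝ} (hr : 0 < r) :
    ∫⁻ y in Metric.closedBall (0 : E) r, ENNReal.ofReal ‖y‖⁻¹ ∂ν ≤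
      4 * ν (Metric.ball 0 1) * ENNReal.ofReal (r ^ (Module.finrank ℝ E - 1)) := by
  obtain ⟨m, hm⟩ : ∃ m, Module.finrank ℝ E = m + 2 := Nat.exists_eq_add_of_le' hn
  calc ∫⁻ y in Metric.closedBall (0 : E) r, ENNReal.ofReal ‖y‖⁻¹ ∂ν
      ≤ ∫⁻ y in Metric.closedBall (0 : E) r, ∑' k : ℕ, ENNReal.ofReal (2 ^ (k + 1) / r) *
          (Metric.closedBall (0 : E) ((1 / 2) ^ k * r)).indicator 1 y ∂ν :=
        setLIntegral_mono' Metric.isClosed_closedBall.measurableSet fun y hy =>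
          ofReal_inv_norm_le_tsum hr (by simpa using hy)
    _ ≤ ∫⁻ y, ∑' k : ℕ, ENNReal.ofReal (2 ^ (k + 1) / r) *
          (Metric.closedBall (0 : E) ((1 / 2) ^ k * r)).indicator 1 y ∂ν :=
        setLIntegral_le_lintegral _ _
    _ = ∑' k : ℕ, ENNReal.ofReal (2 ^ (k + 1) / r) *
          ν (Metric.closedBall (0 : E) ((1 / 2) ^ k * r)) := by
        rw [lintegral_tsum fun k => ((measurable_one.indicator
          Metric.isClosed_closedBall.measurableSet).const_mul _).aemeasurable]
        refine tsum_congr fun k => ?_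
        rw [lintegral_const_mul _ (measurable_one.indicator
          Metric.isClosed_closedBall.measurableSet),
          lintegral_indicator_one Metric.isClosed_closedBall.measurableSet]
    _ ≤ ∑' k : ℕ, 2 * ν (Metric.ball 0 1) * ENNReal.ofReal (r ^ (m + 1)) * 2⁻¹ ^ k := by
        refine ENNReal.tsum_le_tsum fun k => ?_
        have hreal : 2 ^ (k + 1) / r * ((1 / 2) ^ k * r) ^ (m + 2) ≤
            2 * r ^ (m + 1) * (2⁻¹) ^ k := by
          have h1 : (2⁻¹ : ℝ) ^ (m * k) ≤ 1 := pow_le_one₀ (by norm_num) (by norm_num)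
          have h2 : (2 : ℝ) ^ k * 2⁻¹ ^ k = 1 := by
            rw [← mul_pow, mul_inv_cancel₀ two_ne_zero, one_pow]
          calc 2 ^ (k + 1) / r * ((1 / 2) ^ k * r) ^ (m + 2)
              = 2 * r ^ (m + 1) * 2⁻¹ ^ k * (2 ^ k * 2⁻¹ ^ k) * 2⁻¹ ^ (m * k) * (r / r) := by
                rw [one_div]; ring
            _ = 2 * r ^ (m + 1) * 2⁻¹ ^ k * 2⁻¹ ^ (m * k) := by
                rw [h2, div_self hr.ne', mul_one, mul_one]
            _ ≤ _ := mul_le_of_le_one_right (by positivity) h1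
        have h2 : (2 : ℝ≥0∞)⁻¹ ^ k = ENNReal.ofReal (2⁻¹ ^ k) := by
          rw [ENNReal.ofReal_pow (by positivity), ENNReal.ofReal_inv_of_pos two_pos,
            ENNReal.ofReal_ofNat]
        rw [Measure.addHaar_closedBall ν _ (by positivity), hm, ← mul_assoc,
          ← ENNReal.ofReal_mul (by positivity), h2]
        refine (mul_le_mul_left (ENNReal.ofReal_le_ofReal hreal) _).trans (le_of_eq ?_)
        rw [ENNReal.ofReal_mul (by positivity), ENNReal.ofReal_mul two_pos.le,
          ENNReal.ofReal_ofNat]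
        ring
    _ = _ := by
        rw [ENNReal.tsum_mul_left, ENNReal.tsum_geometric, ENNReal.one_sub_inv_two, inv_inv, hm,
          show m + 2 - 1 = m + 1 by omega]
        ring

/-- Split the ball at distance r from the origin: the near part lies in a centred ball (constant 4),
and on the far part the weight is below 1/r (constant 1). -/
theorem withDensity_inv_norm_ball_le (hn : 2 ≤ Module.finrank ℝ E) (x : E) {r : ℝ} (hr : 0 < r) :
    ν.withDensity (fun y => ENNReal.ofReal ‖y‖⁻¹) (Metric.ball x r) ≤
      5 * ν (Metric.ball 0 1) * ENNReal.ofReal (r ^ (Module.finrank ℝ E - 1)) := by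
  have : Nontrivial E := Module.nontrivial_of_finrank_pos (R := ℝ) (by omega)
  rw [withDensity_apply _ Metric.isOpen_ball.measurableSet]
  calc ∫⁻ y in Metric.ball x r, ENNReal.ofReal ‖y‖⁻¹ ∂ν
      ≤ ∫⁻ y in Metric.closedBall 0 r ∪ (Metric.ball x r \ Metric.closedBall 0 r),
          ENNReal.ofReal ‖y‖⁻¹ ∂ν := lintegral_mono_set (by simp)
    _ ≤ (∫⁻ y in Metric.closedBall 0 r, ENNReal.ofReal ‖y‖⁻¹ ∂ν) +
          ∫⁻ y in Metric.ball x r \ Metric.closedBall 0 r, ENNReal.ofReal ‖y‖⁻¹ ∂ν :=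
        lintegral_union_le _ _ _
    _ ≤ 4 * ν (Metric.ball 0 1) * ENNReal.ofReal (r ^ (Module.finrank ℝ E - 1)) +
          ν (Metric.ball 0 1) * ENNReal.ofReal (r ^ (Module.finrank ℝ E - 1)) := by
        refine add_le_add (setLIntegral_inv_norm_closedBall_le ν hn hr) ?_
        calc ∫⁻ y in Metric.ball x r \ Metric.closedBall 0 r, ENNReal.ofReal ‖y‖⁻¹ ∂ν
            ≤ ∫⁻ _ in Metric.ball x r \ Metric.closedBall 0 r, ENNReal.ofReal r⁻¹ ∂ν := by
              refine setLIntegral_mono' (Metric.isOpen_ball.measurableSet.diff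
                Metric.isClosed_closedBall.measurableSet) fun y hy => ENNReal.ofReal_le_ofReal ?_
              have : r < ‖y‖ := by simpa using hy.2
              gcongr
          _ ≤ ENNReal.ofReal r⁻¹ * ν (Metric.ball x r) := by
              rw [setLIntegral_const]
              exact mul_le_mul_right (measure_mono sdiff_subset) _
          _ = _ := by
              rw [Measure.addHaar_ball ν x hr.le, ← mul_assoc, ← ENNReal.ofReal_mul (by positivity),
                mul_comm]
              congr 2
              obtain ⟨m, hm⟩ : ∃ m, Module.finrank ℝ E = m + 2 := Nat.exists_eq_add_of_le' hn
              rw [hm, show m + 2 - 1 = m + 1 by omega, pow_succ]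
              field_simp
    _ = _ := by ring

end HardyWeight

variable {d : ℕ}

theorem exists_lintegral_outerMeasure_superlevel_le_of_isW11
    [Nontrivial (EuclideanSpace ℝ (Fin d))] : ∃ C : ℝ≥0∞, C ≠ ⊤ ∧
    ∀ (Φ : OuterMeasure (EuclideanSpace ℝ (Fin d))) (K : ℝ≥0∞), K ≠ ⊤ →
      (∀ A, volume A = 0 → Φ A = 0) →
      (∀ A : ℕ → Set (EuclideanSpace ℝ (Fin d)), Monotone A → Φ (⋃ n, A n) ≤ ⨆ n, Φ (A n)) →
      (∀ (x : EuclideanSpace ℝ (Fin d)) (r : ℝ), 0 < r →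
        Φ (Metric.ball x r) ≤ K * ENNReal.ofReal (r ^ (d - 1))) →
    ∀ (u : EuclideanSpace ℝ (Fin d) → ℝ)
      (G : EuclideanSpace ℝ (Fin d) → EuclideanSpace ℝ (Fin d)), IsW11 u G →
      ∫⁻ t in Ioi (0 : ℝ), Φ {x | t < |u x|} ≤ C * K * ENNReal.ofReal (∫ x, ‖G x‖) := by
  obtain ⟨C, hC, h⟩ := exists_lintegral_outerMeasure_superlevel_le
    (volume : Measure (EuclideanSpace ℝ (Fin d)))
  rw [finrank_euclideanSpace_fin] at h
  refine ⟨C, hC, fun Φ K hK hnull hmono hΦ u G hu => ?_⟩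
  obtain ⟨v, hv, hvi, hvu, hvG⟩ := hu.exists_contDiff_approx
  rw [← hu.lintegral_enorm_innerSL]
  exact lintegral_outerMeasure_superlevel_le_of_approx volume Φ hnull hmono
    (ENNReal.mul_ne_top hC hK) (h Φ K hK hΦ) hu.integrable.1 hv hvi hvu
    ((innerSL ℝ).continuous.comp_aestronglyMeasurable hu.integrable_grad.1) hvG

/-- The exponent is (d-1)/d, for which the power of the volume of a ball is exactly a constant times
r^(d-1). -/
theorem exists_lintegral_rpow_volume_superlevel_le (hd : 2 ≤ d) : ∃ C : ℝ≥0∞, C ≠ ⊤ ∧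
    ∀ (u : EuclideanSpace ℝ (Fin d) → ℝ)
      (G : EuclideanSpace ℝ (Fin d) → EuclideanSpace ℝ (Fin d)), IsW11 u G →
      ∫⁻ t in Ioi (0 : ℝ), volume {x | t < |u x|} ^ (1 / ((d : ℝ) / ((d : ℝ) - 1))) ≤
        C * ENNReal.ofReal (∫ x, ‖G x‖) := by
  have : Nontrivial (EuclideanSpace ℝ (Fin d)) :=
    Module.nontrivial_of_finrank_pos (R := ℝ) (by rw [finrank_euclideanSpace_fin]; omega)
  obtain ⟨C, hC, h⟩ := exists_lintegral_outerMeasure_superlevel_le_of_isW11 (d := d)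
  have hd' : (2 : ℝ) ≤ d := by exact_mod_cast hd
  set s : ℝ := 1 / ((d : ℝ) / ((d : ℝ) - 1)) with hs
  have hsd : s = ((d : ℝ) - 1) / d := by rw [hs, one_div_div]
  have hs0 : 0 < s := by rw [hsd]; apply div_pos <;> linarith
  have hs1 : s ≤ 1 := by rw [hsd, div_le_one (by linarith)]; linarith
  set κ := volume (Metric.ball (0 : EuclideanSpace ℝ (Fin d)) 1)
  have hκ : κ ^ s ≠ ⊤ := ENNReal.rpow_ne_top_of_nonneg hs0.le measure_ball_lt_top.ne
  refine ⟨C * κ ^ s, ENNReal.mul_ne_top hC hκ, fun u G hu => ?_⟩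
  refine h (rpowOuterMeasure volume hs0 hs1) _ hκ (fun A hA => ?_) (fun A hA => ?_)
    (fun x r hr => ?_) u G hu
  · rw [rpowOuterMeasure_apply, hA, ENNReal.zero_rpow_of_pos hs0]
  · simp only [rpowOuterMeasure_apply]
    rw [hA.measure_iUnion, ENNReal.iSup_rpow _ hs0]
  · rw [rpowOuterMeasure_apply, Measure.addHaar_ball volume x hr.le, finrank_euclideanSpace_fin,
      ENNReal.mul_rpow_of_nonneg _ _ hs0.le, mul_comm,
      ENNReal.ofReal_rpow_of_pos (by positivity), ← Real.rpow_natCast, ← Real.rpow_natCast,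
      ← Real.rpow_mul hr.le, hsd, mul_div_cancel₀ _ (by linarith : (d : ℝ) ≠ 0),
      Nat.cast_sub (by omega), Nat.cast_one]

/-- The added 1 makes the real constant strictly positive even when c = 0. -/
theorem mul_ofReal_le_ofReal_toReal_add_one_mul {c : ℝ≥0∞} (hc : c ≠ ⊤) (a : ℝ) :
    c * ENNReal.ofReal a ≤ ENNReal.ofReal ((c.toReal + 1) * a) := by
  rw [ENNReal.ofReal_mul (by positivity)]
  refine mul_le_mul_left ?_ _
  rw [ENNReal.le_ofReal_iff_toReal_le hc (by positivity)]
  linarith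

theorem lorentzNorm_one (p : ℝ) (f : EuclideanSpace ℝ (Fin d) → ℝ) :
    lorentzNorm p 1 f =
      ENNReal.ofReal p * ∫⁻ t in Ioi (0 : ℝ), volume {x | t < |f x|} ^ (1 / p) := by
  simp only [lorentzNorm, div_one, ENNReal.rpow_one]
  congr 1
  refine setLIntegral_congr_fun measurableSet_Ioi fun t ht => ?_
  have h0 : ENNReal.ofReal t ≠ 0 := by simpa using ht
  rw [mul_comm, ENNReal.mul_div_cancel_right h0 ENNReal.ofReal_ne_top]

/-- Here Φ is the measure dx/|x|, absolutely continuous with the required growth; the layer-cake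
formula turns its level integral into the Hardy integral. -/
theorem exists_lintegral_div_norm_le (hd : 2 ≤ d) : ∃ C : ℝ≥0∞, C ≠ ⊤ ∧
    ∀ (u : EuclideanSpace ℝ (Fin d) → ℝ)
      (G : EuclideanSpace ℝ (Fin d) → EuclideanSpace ℝ (Fin d)), IsW11 u G →
      ∫⁻ x, ENNReal.ofReal (|u x| / ‖x‖) ≤ C * ENNReal.ofReal (∫ x, ‖G x‖) := by
  have : Nontrivial (EuclideanSpace ℝ (Fin d)) :=
    Module.nontrivial_of_finrank_pos (R := ℝ) (by rw [finrank_euclideanSpace_fin]; omega)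
  obtain ⟨C, hC, h⟩ := exists_lintegral_outerMeasure_superlevel_le_of_isW11 (d := d)
  set f : EuclideanSpace ℝ (Fin d) → ℝ≥0∞ := fun y => ENNReal.ofReal ‖y‖⁻¹ with hf
  have hfm : Measurable f := measurable_norm.inv.ennreal_ofReal
  set K : ℝ≥0∞ := 5 * volume (Metric.ball (0 : EuclideanSpace ℝ (Fin d)) 1)
  have hK : K ≠ ⊤ := ENNReal.mul_ne_top (by simp) measure_ball_lt_top.ne
  have hac : volume.withDensity f ≪ volume := withDensity_absolutelyContinuous _ _
  refine ⟨C * K, ENNReal.mul_ne_top hC hK, fun u G hu => ?_⟩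
  have hmain := h (volume.withDensity f).toOuterMeasure K hK (fun A hA => hac hA)
    (fun A hA => hA.measure_iUnion.le)
    (fun x r hr => by
      have := withDensity_inv_norm_ball_le volume (by rwa [finrank_euclideanSpace_fin]) x hr
      rwa [finrank_euclideanSpace_fin] at this) u G hu
  have hum : AEMeasurable (fun x => |u x|) := hu.integrable.1.norm.aemeasurable
  have hlayer := lintegral_eq_lintegral_meas_lt (volume.withDensity f) (f := fun x => |u x|)
    (Eventually.of_forall fun x => abs_nonneg (u x)) (hum.mono_ac hac)
  rw [lintegral_withDensity_eq_lintegral_mul₀ hfm.aemeasurable hum.ennreal_ofReal] at hlayer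
  refine le_trans (le_of_eq ?_) hmain
  refine Eq.trans (lintegral_congr fun x => ?_) hlayer
  rw [Pi.mul_apply, hf, ← ENNReal.ofReal_mul (by positivity), div_eq_inv_mul]

end Consequences

theorem mainTheorem4 (d : ℕ) (hd : 1 ≤ d) :
    -- the trace inequality
    (∃ C : ℝ, 0 < C ∧
      ∀ (C' : ℝ), 0 < C' →
      ∀ (μ : Measure (EuclideanSpace ℝ (Fin d))) [μ.Regular],
      (∀ (x : EuclideanSpace ℝ (Fin d)) (r : ℝ), 0 < r →
        μ (Metric.ball x r) ≤ ENNReal.ofReal (C' * r ^ (d - 1))) →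
      ∀ (u : EuclideanSpace ℝ (Fin d) → ℝ)
        (G : EuclideanSpace ℝ (Fin d) → EuclideanSpace ℝ (Fin d)), IsW11 u G →
        (∀ᵐ x ∂μ, ∃ l : ℝ, IsLimitOfAverages u x l) ∧
        Integrable (preciseRep u) μ ∧
        ∫ x, |preciseRep u x| ∂μ ≤ C * C' * ∫ x, ‖G x‖) ∧
    -- its consequences in dimension at least two
    (2 ≤ d →
      -- Alvino's inequality
      (∃ C : ℝ, 0 < C ∧
        ∀ (u : EuclideanSpace ℝ (Fin d) → ℝ)
          (G : EuclideanSpace ℝ (Fin d) → EuclideanSpace ℝ (Fin d)), IsW11 u G →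
          lorentzNorm ((d : ℝ) / ((d : ℝ) - 1)) 1 u ≤ ENNReal.ofReal (C * ∫ x, ‖G x‖)) ∧
      -- the Gagliardo-Nirenberg inequality
      (∃ C : ℝ, 0 < C ∧
        ∀ (u : EuclideanSpace ℝ (Fin d) → ℝ)
          (G : EuclideanSpace ℝ (Fin d) → EuclideanSpace ℝ (Fin d)), IsW11 u G →
          eLpNorm u (ENNReal.ofReal ((d : ℝ) / ((d : ℝ) - 1))) volume
            ≤ ENNReal.ofReal (C * ∫ x, ‖G x‖)) ∧
      -- Hardy's inequality
      (∃ C : ℝ, 0 < C ∧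
        ∀ (u : EuclideanSpace ℝ (Fin d) → ℝ)
          (G : EuclideanSpace ℝ (Fin d) → EuclideanSpace ℝ (Fin d)), IsW11 u G →
          Integrable (fun x => |u x| / ‖x‖) ∧
          ∫ x, |u x| / ‖x‖ ≤ C * ∫ x, ‖G x‖)) := by
  have hI : ∀ G : EuclideanSpace ℝ (Fin d) → EuclideanSpace ℝ (Fin d), 0 ≤ ∫ x, ‖G x‖ :=
    fun G => integral_nonneg fun x => norm_nonneg _
  refine ⟨?_, fun hd2 => ⟨?_, ?_, ?_⟩⟩
  · have : Nontrivial (EuclideanSpace ℝ (Fin d)) :=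
      Module.nontrivial_of_finrank_pos (R := ℝ) (by rw [finrank_euclideanSpace_fin]; omega)
    obtain ⟨C, hC, h⟩ := exists_trace_bound (d := d)
    refine ⟨C.toReal + 1, by positivity, fun C' hC' μ _ hμ u G hu => ?_⟩
    obtain ⟨hlim, hbound⟩ := h μ (ENNReal.ofReal C') ENNReal.ofReal_ne_top
      (fun x r hr => by rw [← ENNReal.ofReal_mul hC'.le]; exact hμ x r hr) u G hu
    rw [mul_assoc, ← ENNReal.ofReal_mul hC'.le] at hbound
    have hbound' := hbound.trans
      (mul_ofReal_le_ofReal_toReal_add_one_mul hC _)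
    have hint : Integrable (preciseRep u) μ :=
      ⟨aestronglyMeasurable_preciseRep hu.integrable.1 hlim,
        hbound'.trans_lt ENNReal.ofReal_lt_top⟩
    refine ⟨hlim, hint, ?_⟩
    have hnonneg : 0 ≤ (C.toReal + 1) * (C' * ∫ x, ‖G x‖) :=
      mul_nonneg (by positivity) (mul_nonneg hC'.le (hI G))
    rw [← ofReal_integral_norm_eq_lintegral_enorm hint,
      ENNReal.ofReal_le_ofReal_iff hnonneg, ← mul_assoc] at hbound'
    exact hbound'
  · obtain ⟨C, hC, h⟩ := exists_lintegral_rpow_volume_superlevel_le hd2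
    have hc : ENNReal.ofReal ((d : ℝ) / ((d : ℝ) - 1)) * C ≠ ⊤ :=
      ENNReal.mul_ne_top ENNReal.ofReal_ne_top hC
    refine ⟨_, add_pos_of_nonneg_of_pos ENNReal.toReal_nonneg one_pos, fun u G hu =>
      le_trans ?_ (mul_ofReal_le_ofReal_toReal_add_one_mul hc _)⟩
    rw [lorentzNorm_one, mul_assoc]
    exact mul_le_mul_right (h u G hu) _
  · obtain ⟨C, hC, h⟩ := exists_lintegral_rpow_volume_superlevel_le hd2
    have hd' : (2 : ℝ) ≤ d := by exact_mod_cast hd2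
    have hp : 1 ≤ (d : ℝ) / ((d : ℝ) - 1) := by rw [le_div_iff₀ (by linarith)]; linarith
    set p : ℝ := (d : ℝ) / ((d : ℝ) - 1)
    have hc : ENNReal.ofReal p ^ (1 / p) * C ≠ ⊤ :=
      ENNReal.mul_ne_top (ENNReal.rpow_ne_top_of_nonneg (by positivity) ENNReal.ofReal_ne_top) hC
    refine ⟨_, add_pos_of_nonneg_of_pos ENNReal.toReal_nonneg one_pos, fun u G hu =>
      le_trans ?_ (mul_ofReal_le_ofReal_toReal_add_one_mul hc _)⟩
    rw [mul_assoc]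
    exact (eLpNorm_le_lintegral_rpow_measure_lt volume hu.integrable.1 hp).trans
      (mul_le_mul_right (h u G hu) _)
  · obtain ⟨C, hC, h⟩ := exists_lintegral_div_norm_le hd2
    refine ⟨C.toReal + 1, by positivity, fun u G hu => ?_⟩
    have hbound := (h u G hu).trans (mul_ofReal_le_ofReal_toReal_add_one_mul hC _)
    have hnn : ∀ x, 0 ≤ |u x| / ‖x‖ := fun x => by positivity
    have hm : AEStronglyMeasurable fun x => |u x| / ‖x‖ :=
      (hu.integrable.1.norm.aemeasurable.div measurable_norm.aemeasurable).aestronglyMeasurable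
    have hint : Integrable fun x => |u x| / ‖x‖ := by
      refine ⟨hm, (hasFiniteIntegral_iff_ofReal (Eventually.of_forall hnn)).2 ?_⟩
      exact hbound.trans_lt ENNReal.ofReal_lt_top
    refine ⟨hint, ?_⟩
    rwa [← ofReal_integral_eq_lintegral_ofReal hint (Eventually.of_forall hnn),
      ENNReal.ofReal_le_ofReal_iff (mul_nonneg (by positivity) (hI G))] at hbound
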